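/- Let $d\ge 1$. For $v\in L^1(\mathbb R^d)$ and $u\in L^1(\mathbb R^d)$ (complex valued) put $$\mathcal F v(\xi)=\frac1{(2\pi)^d}\int_{\mathbb R^d}e^{i\xi x}v(x)\,dx,\qquad \mathcal F^{-1}u(x)=\int_{\mathbb R^d}u(\xi)e^{-i\xi x}\,d\xi .$$ For $r>0$, $R\ge r$, $n\in\{0,1,2,\dots\}$ and a bounded measurable $w:[-r,r]^d\to\mathbb C$ define $$\mathcal C_{R,n}[w](\xi)=\begin{cases} w(\xi), & \xi\in[-r,r]^d,\\ \displaystyle\sum_{k\in\mathbb N^d,\;k_1+\dots+k_d<n} a_k[w]\prod_{j=1}^dT_{k_j}(\xi_j/r), & \xi\in[-R,R]^d\setminus[-r,r]^d,\\ 0,&\xi\notin[-R,R]^d,\end{cases}$$ where $\mathbb N=\{0,1,\dots\}$, $T_k$ are the Chebyshev polynomials of the first kind and $$a_k[w]=\int_{[-r,r]^d}w(\xi)\prod_{j=1}^d\frac{2^{\mathbf 1[k_j>0]}\,T_{k_j}(\xi_j/r)}{\pi\,(r^2-\xi_j^2)^{1/2}}\,d\xi .$$ For $0<\delta<N$, $\sigma>0$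 and $\tau\in[0,1]$ let $$L_\tau(\delta)=\max\Big\{1,\ \tfrac14\Big(\tfrac{(1-\tau)\ln(N/\delta)}{r\sigma}\Big)^{\tau}\Big\}\quad(\text{with }0^0=1),\qquad R_\tau(\delta)=rL_\tau(\delta),$$ $$n_\tau(\delta)=\left\lceil\frac{(2-\tau)\ln(N/\delta)}{\ln 3+\frac1\tau\ln(4L_\tau(\delta))}\right\rceil\ \text{ if }\tau>0,\qquad n_0(\delta)=0,$$ and $\mathcal C^*_{\tau,\delta}=\mathcal C_{R_\tau(\delta),\,n_\tau(\delta)}$. **Theorem.** Let $N,\delta,r,\sigma,\gamma>0$ with $\delta<N$, and let $m\ge1$ be an integer. Let $v:\mathbb R^d\to\mathbb C$ satisfy $\|v\|_{L^1(\mathbb R^d)}\le(2\pi)^dN$, $\operatorname{supp}v\subseteq\{x:\sum_{j}|x_j|\le\sigma\}$, $v\in H^m(\mathbb R^d)$ and $$|v|_{H^m(\mathbb R^d)}:=\Big(\sum_{j=1}^d\Big\|\frac{\partial^mv}{(\partial x_j)^m}\Big\|_{L^2(\mathbb R^d)}^2\Big)^{1/2}\le\gamma ,$$ and let $w:[-r,r]^d\to\mathbb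 C$ be measurable with $\|w-\mathcal Fv\|_{L^\infty([-r,r]^d)}\le\delta$. Then for every $\tau\in[0,1]$ the function $\mathcal C^*_{\tau,\delta}[w]$ is integrable on $\mathbb R^d$ (so that its inverse Fourier transform is defined), $v-\mathcal F^{-1}\mathcal C^*_{\tau,\delta}[w]\in L^2(\mathbb R^d)$, and $$\big\|v-\mathcal F^{-1}\mathcal C^*_{\tau,\delta}[w]\big\|_{L^2(\mathbb R^d)}\le(20\sqrt r)^d\,N\,L_\tau(\delta)^{d/2+1}\Big(\frac\delta N\Big)^{(1-\tau)^2}+\gamma\,\big(rL_\tau(\delta)\big)^{-m}.$$ -/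

import Mathlib

open MeasureTheory
open scoped ENNReal SchwartzMap LineDeriv

noncomputable section

namespace FourierSynthesis

/-- The closed cube `[-R, R]^d`. -/
def cube (d : ℕ) (R : ℝ) : Set (EuclideanSpace ℝ (Fin d)) :=
  {ξ | ∀ j, ξ j ∈ Set.Icc (-R) R}

/-- The Fourier transform `(𝓕 v)(ξ) = (2π)^{-d} ∫ e^{i ξ·x} v(x) dx`. -/
def fourierTransform {d : ℕ} (v : EuclideanSpace ℝ (Fin d) → ℂ)
    (ξ : EuclideanSpace ℝ (Fin d)) : ℂ :=
  (1 / (2 * (Real.pi : ℂ)) ^ d) *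
    ∫ x : EuclideanSpace ℝ (Fin d), Complex.exp (Complex.I * ((inner ℝ ξ x : ℝ) : ℂ)) * v x

/-- The inverse Fourier transform `(𝓕⁻¹ u)(x) = ∫ u(ξ) e^{-i ξ·x} dξ`. -/
def inverseFourierTransform {d : ℕ} (u : EuclideanSpace ℝ (Fin d) → ℂ)
    (x : EuclideanSpace ℝ (Fin d)) : ℂ :=
  ∫ ξ : EuclideanSpace ℝ (Fin d), u ξ * Complex.exp (-(Complex.I * ((inner ℝ ξ x : ℝ) : ℂ)))

/-- The Chebyshev coefficient `a_{k_1,…,k_d}[w]` of data `w` given on `[-r, r]^d`. -/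
def chebyshevCoeff {d : ℕ} (r : ℝ) (w : EuclideanSpace ℝ (Fin d) → ℂ) (k : Fin d → ℕ) : ℂ :=
  ∫ ξ in cube d r, w ξ *
    ((∏ j : Fin d,
      (2 ^ (if 0 < k j then 1 else 0) * (Polynomial.Chebyshev.T ℝ (k j : ℤ)).eval (ξ j / r)) /
        (Real.pi * Real.sqrt (r ^ 2 - ξ j ^ 2)) : ℝ) : ℂ)

/-- The multi-indices `k ∈ ℕ^d` with `k_1 + ⋯ + k_d < n`. -/
def multiIndices (d n : ℕ) : Finset (Fin d → ℕ) :=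
  (Fintype.piFinset fun _ : Fin d => Finset.range n).filter fun k => ∑ j, k j < n

/-- The range restriction in `multiIndices` is harmless. -/
theorem mem_multiIndices {d n : ℕ} {k : Fin d → ℕ} :
    k ∈ multiIndices d n ↔ ∑ j, k j < n := by
  simp only [multiIndices, Finset.mem_filter, Fintype.mem_piFinset, Finset.mem_range,
    and_iff_right_iff_imp]
  intro h j
  exact lt_of_le_of_lt (Finset.single_le_sum (fun i _ => Nat.zero_le (k i)) (Finset.mem_univ j)) h

open Classical in
/-- The extrapolation `𝒞_{R,n}[w]` of data `w` given on `[-r, r]^d`: it is `w` on `[-r, r]^d`, the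
truncated Chebyshev series of `w` on `[-R, R]^d ∖ [-r, r]^d`, and `0` outside `[-R, R]^d`. It only
uses the values of `w` on `[-r, r]^d`. -/
def extrapolation {d : ℕ} (r R : ℝ) (n : ℕ) (w : EuclideanSpace ℝ (Fin d) → ℂ)
    (ξ : EuclideanSpace ℝ (Fin d)) : ℂ :=
  if ξ ∈ cube d r then w ξ
  else if ξ ∈ cube d R then
    ∑ k ∈ multiIndices d n, chebyshevCoeff r w k *
      ((∏ j : Fin d, (Polynomial.Chebyshev.T ℝ (k j : ℤ)).eval (ξ j / r) : ℝ) : ℂ)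
  else 0

/-- `L_τ(δ) = max {1, ¼ ((1 - τ) ln (N/δ) / (r σ))^τ}`. -/
def extrapolationFactor (N r σ τ δ : ℝ) : ℝ :=
  max 1 (1 / 4 * ((1 - τ) * Real.log (N / δ) / (r * σ)) ^ τ)

/-- `R_τ(δ) = r L_τ(δ)`. -/
def extrapolationRadius (N r σ τ δ : ℝ) : ℝ :=
  r * extrapolationFactor N r σ τ δ

/-- `n_τ(δ) = ⌈(2 - τ) ln (N/δ) / (ln 3 + (1/τ) ln (4 L_τ(δ)))⌉` if `τ > 0`, and `0` otherwise. -/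
def truncationOrder (N r σ τ δ : ℝ) : ℕ :=
  if 0 < τ then
    ⌈(2 - τ) * Real.log (N / δ) /
      (Real.log 3 + 1 / τ * Real.log (4 * extrapolationFactor N r σ τ δ))⌉₊
  else 0

/-- The extrapolation `𝒞*_{τ,δ} = 𝒞_{R_τ(δ), n_τ(δ)}`. -/
def optimalExtrapolation {d : ℕ} (N r σ τ δ : ℝ) (w : EuclideanSpace ℝ (Fin d) → ℂ) :
    EuclideanSpace ℝ (Fin d) → ℂ :=
  extrapolation r (extrapolationRadius N r σ τ δ) (truncationOrder N r σ τ δ) w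

/-- The `L²` norm of a tempered distribution: `‖f‖_{L²}` if it is represented by `f ∈ L²`
(which is then unique), and `∞` if it is not represented by an `L²` function. -/
def l2Norm {d : ℕ} (u : 𝓢'(EuclideanSpace ℝ (Fin d), ℂ)) : ℝ≥0∞ :=
  ⨅ (f : Lp ℂ 2 (volume : Measure (EuclideanSpace ℝ (Fin d))))
    (_ : u = (f : 𝓢'(EuclideanSpace ℝ (Fin d), ℂ))), ‖f‖ₑ

/-- The Sobolev seminorm `|u|_{H^m} = (∑_j ‖∂^m u / (∂x_j)^m‖²_{L²})^{1/2}`, with distributional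
derivatives. -/
def sobolevSeminorm {d : ℕ} (m : ℕ) (u : 𝓢'(EuclideanSpace ℝ (Fin d), ℂ)) : ℝ≥0∞ :=
  (∑ j : Fin d,
    l2Norm (∂^{fun _ : Fin m => EuclideanSpace.single j (1 : ℝ)} u) ^ 2) ^ (1 / 2 : ℝ)

end FourierSynthesis

end

open MeasureTheory
open scoped ENNReal SchwartzMap LineDeriv

noncomputable section

namespace FourierSynthesis

open scoped FourierTransform

/-! By Plancherel the error is `(2π)^{d/2}` times the `L²` norm of `𝓕 v - C`, where `C` is the
extrapolation; split this norm at the cube of half-side `rL`. Outside it `C = 0` and some `|ξ_j| >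
rL`, so the multiplier `ξ_j^m` of the `m`-th derivative yields the term `γ (rL)^{-m}`. Inside it a
uniform bound times the square root of the volume gives the first term.

The uniform bound rests on the Chebyshev series of plane waves. The Jacobi–Anger expansion of
`e^{izt}` holds for all real `t`, and its coefficients are summable against `A^k` for every `A > 0`
(`summable_jacobiAngerCoeff_mul`). As `T_k` grows at most like `(2L)^k` on `[-L, L]`, taking `A =
2Lρ` makes the tail of total degree at least `n` a multiple of `ρ^{-n}`. Integrating against `v`,
whose support is bounded in the `ℓ¹` norm, transfers this to `𝓕 v`. The noise `w - 𝓕 v` contributes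
at most `δ 3^d (4L)^n` when the truncation order is `n + 1`.

`exists_truncation_rate` balances the two errors. With `l = ln(N/δ)` and `q = (1-τ) l / (rσ)`,
nontrivial extrapolation means `4L = q^τ`; the choice `ρ = (3q)^{1-τ}` makes both contributions of
order `N (δ/N)^{(1-τ)^2}`, with constants `2^d` and `3^d`, whose sum is at most `5^d`. -/

/-! ### Growth of Chebyshev polynomials and the Jacobi–Anger expansion. -/

open Polynomial.Chebyshev in
/-- The growth bound `|T_n(t)| ≤ (2L)^{|n|}` for `|t| ≤ L`, `L ≥ 1`. -/
theorem abs_eval_T_le {L t : ℝ} (hL : 1 ≤ L) (ht : |t| ≤ L) (n : ℤ) :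
    |(T ℝ n).eval t| ≤ (2 * L) ^ n.natAbs := by
  rw [← T_natAbs]
  generalize n.natAbs = k
  rcases le_or_gt |t| 1 with h | h
  · exact (abs_eval_T_real_le_one _ h).trans (one_le_pow₀ (by linarith))
  · have key : |(T ℝ (k : ℤ)).eval t| = |(T ℝ (k : ℤ)).eval (|t|)| := by
      rcases abs_choice t with h' | h' <;> rw [h']
      rw [T_eval_neg]
      rcases Int.even_or_odd (k : ℤ) with h2 | h2
      · simp [Int.negOnePow_even _ h2]
      · simp [Int.negOnePow_odd _ h2]
    -- With `|t| = cosh s`, `s ≥ 0`: `T_k(|t|) = cosh (ks) ≤ (e^s)^k`, and `e^s ≤ 2 cosh s ≤ 2L`.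
    rw [key, ← Real.cosh_arcosh h.le, T_real_cosh]
    have h0 := Real.arcosh_nonneg h.le
    rw [abs_of_pos (Real.cosh_pos _)]
    have h1 : Real.cosh ((k : ℤ) * Real.arcosh |t|) ≤ Real.exp (k * Real.arcosh |t|) := by
      rw [Real.cosh_eq]
      have : Real.exp (-((k : ℝ) * Real.arcosh |t|)) ≤ Real.exp (k * Real.arcosh |t|) :=
        Real.exp_le_exp.2 (by have : 0 ≤ (k : ℝ) * Real.arcosh |t| := by positivity
                              linarith)
      push_cast
      linarith
    refine h1.trans ?_
    rw [Real.exp_nat_mul]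
    refine pow_le_pow_left₀ (Real.exp_pos _).le ?_ _
    have h3 := Real.cosh_arcosh h.le
    rw [Real.cosh_eq] at h3
    have := Real.exp_pos (-Real.arcosh |t|)
    linarith

/-- The coefficients of `e^{izt} = ∑_{a,b} (iz/2)^{a+b} / (a! b!) T_{a-b}(t)`. -/
def jacobiAngerTerm (z : ℝ) (p : ℕ × ℕ) : ℂ :=
  ((Complex.I * z / 2) ^ p.1 / p.1.factorial) * ((Complex.I * z / 2) ^ p.2 / p.2.factorial)

theorem norm_jacobiAngerTerm (z : ℝ) (p : ℕ × ℕ) :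
    ‖jacobiAngerTerm z p‖ =
      ((|z| / 2) ^ p.1 / p.1.factorial) * ((|z| / 2) ^ p.2 / p.2.factorial) := by
  simp [jacobiAngerTerm]

theorem hasSum_exp_series (u : ℂ) :
    HasSum (fun n : ℕ => u ^ n / n.factorial) (Complex.exp u) := by
  rw [Complex.exp_eq_exp_ℂ]
  exact NormedSpace.expSeries_div_hasSum_exp u

theorem summable_norm_exp_series (u : ℂ) : Summable fun n : ℕ => ‖u ^ n / n.factorial‖ :=
  NormedSpace.norm_expSeries_div_summable u

theorem hasSum_mul_of_summable_norm {ι κ : Type*} {f : ι → ℂ} {g : κ → ℂ} {a b : ℂ}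
    (hf : HasSum f a) (hg : HasSum g b) (hf' : Summable fun i => ‖f i‖)
    (hg' : Summable fun i => ‖g i‖) :
    HasSum (fun p : ι × κ => f p.1 * g p.2) (a * b) :=
  hf.mul hg (summable_mul_of_summable_norm hf' hg')

theorem hasSum_exp_mul_exp (u w : ℂ) :
    HasSum (fun p : ℕ × ℕ => (u ^ p.1 / (p.1.factorial : ℂ)) * (w ^ p.2 / (p.2.factorial : ℂ)))
      (Complex.exp u * Complex.exp w) := by
  have := hasSum_mul_of_summable_norm (hasSum_exp_series u) (hasSum_exp_series w)
    (summable_norm_exp_series u) (summable_norm_exp_series w)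
  exact this

theorem hasSum_real_exp_mul_exp (u w : ℝ) :
    HasSum (fun p : ℕ × ℕ => (u ^ p.1 / p.1.factorial) * (w ^ p.2 / p.2.factorial))
      (Real.exp u * Real.exp w) := by
  have := hasSum_exp_mul_exp (u : ℂ) w
  exact_mod_cast this

open Polynomial.Chebyshev in
/-- The Jacobi–Anger expansion. -/
theorem hasSum_jacobiAnger (z t : ℝ) :
    HasSum (fun p : ℕ × ℕ => jacobiAngerTerm z p * ((T ℝ ((p.1 : ℤ) - p.2)).eval t : ℝ))
      (Complex.exp (Complex.I * (z * t))) := by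
  -- A complex angle `θ` reaches every real `t`, including `|t| > 1`, where the extrapolation takes
  -- place.
  obtain ⟨θ, hθ⟩ := Complex.cos_surjective (t : ℂ)
  set w : ℂ := Complex.I * z / 2
  -- `e^{iz cos θ}` factors as `exp(w e^{iθ}) exp(w e^{-iθ})`. Averaging the double series with its
  -- mirror image `θ ↦ -θ` turns `e^{i(a-b)θ}` into `cos((a-b)θ) = T_{a-b}(t)`.
  have h1 := hasSum_exp_mul_exp (w * Complex.exp (Complex.I * θ)) (w * Complex.exp (-(Complex.I * θ)))
  have h2 := hasSum_exp_mul_exp (w * Complex.exp (-(Complex.I * θ))) (w * Complex.exp (Complex.I * θ))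
  have h3 := (h1.add h2).div_const 2
  convert! h3 using 1
  · ext p
    have hT : (((T ℝ ((p.1 : ℤ) - p.2)).eval t : ℝ) : ℂ) = Complex.cos (((p.1 : ℤ) - p.2 : ℤ) * θ) := by
      rw [← T_complex_cos, hθ]
      simp
    rw [hT, Complex.cos, jacobiAngerTerm]
    push_cast
    simp only [mul_pow, ← Complex.exp_nat_mul]
    have e1 : Complex.exp (((p.1 : ℂ) - p.2) * θ * Complex.I) =
        Complex.exp (p.1 * (Complex.I * θ)) * Complex.exp (p.2 * -(Complex.I * θ)) := by
      rw [← Complex.exp_add]; congr 1; ring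
    have e2 : Complex.exp (-(((p.1 : ℂ) - p.2) * θ) * Complex.I) =
        Complex.exp (p.1 * -(Complex.I * θ)) * Complex.exp (p.2 * (Complex.I * θ)) := by
      rw [← Complex.exp_add]; congr 1; ring
    rw [e1, e2]
    ring
  · rw [mul_comm (Complex.exp (w * Complex.exp (-(Complex.I * θ)))), add_self_div_two, ← Complex.exp_add]
    congr 1
    rw [← hθ, Complex.cos]
    have : θ * Complex.I = Complex.I * θ := mul_comm _ _
    rw [neg_mul, this]
    ring

/-- The `k`-th Chebyshev coefficient of `t ↦ e^{izt}`. -/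
def jacobiAngerCoeff (z : ℝ) (k : ℕ) : ℂ :=
  ∑' p : ℕ × ℕ, if ((p.1 : ℤ) - p.2).natAbs = k then jacobiAngerTerm z p else 0

/-- Since `A^{|a-b|} ≤ A^{a-b} + A^{b-a}`, the weighted series is dominated by two products of
exponential series, each with sum `exp(|z|/2 (A + A⁻¹))`. -/
theorem summable_jacobiAngerTerm_mul {A : ℝ} (hA : 0 < A) (z : ℝ) :
    Summable (fun p : ℕ × ℕ => ‖jacobiAngerTerm z p‖ * A ^ ((p.1 : ℤ) - p.2).natAbs) ∧
    ∑' p : ℕ × ℕ, ‖jacobiAngerTerm z p‖ * A ^ ((p.1 : ℤ) - p.2).natAbs ≤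
      2 * Real.exp (|z| / 2 * (A + A⁻¹)) := by
  have h1 := hasSum_real_exp_mul_exp (|z| / 2 * A) (|z| / 2 * A⁻¹)
  have h2 := hasSum_real_exp_mul_exp (|z| / 2 * A⁻¹) (|z| / 2 * A)
  have h3 := h1.add h2
  have hle : ∀ p : ℕ × ℕ, ‖jacobiAngerTerm z p‖ * A ^ ((p.1 : ℤ) - p.2).natAbs ≤
      (|z| / 2 * A) ^ p.1 / p.1.factorial * ((|z| / 2 * A⁻¹) ^ p.2 / p.2.factorial) +
      (|z| / 2 * A⁻¹) ^ p.1 / p.1.factorial * ((|z| / 2 * A) ^ p.2 / p.2.factorial) := by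
    intro p
    have key : A ^ ((p.1 : ℤ) - p.2).natAbs ≤ A ^ p.1 * A⁻¹ ^ p.2 + A⁻¹ ^ p.1 * A ^ p.2 := by
      rcases le_total p.2 p.1 with h | h
      · have : ((p.1 : ℤ) - p.2).natAbs = p.1 - p.2 := by omega
        rw [this, pow_sub₀ _ hA.ne' h, ← inv_pow]
        have : 0 ≤ A⁻¹ ^ p.1 * A ^ p.2 := by positivity
        linarith
      · have : ((p.1 : ℤ) - p.2).natAbs = p.2 - p.1 := by omega
        rw [this, pow_sub₀ _ hA.ne' h, ← inv_pow, mul_comm]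
        have : 0 ≤ A ^ p.1 * A⁻¹ ^ p.2 := by positivity
        linarith
    rw [norm_jacobiAngerTerm]
    refine (mul_le_mul_of_nonneg_left key (by positivity)).trans_eq ?_
    simp only [mul_pow]
    ring
  have hs := Summable.of_nonneg_of_le (fun p => by positivity) hle h3.summable
  refine ⟨hs, (hs.tsum_le_tsum hle h3.summable).trans_eq ?_⟩
  rw [h3.tsum_eq, ← Real.exp_add, ← Real.exp_add]
  ring_nf

theorem summable_norm_jacobiAngerTerm (z : ℝ) : Summable fun p => ‖jacobiAngerTerm z p‖ := by
  simpa using (summable_jacobiAngerTerm_mul one_pos z).1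

/-- Regrouping a family on `ι` along the fibres of `g : ι → ℕ`. -/
theorem hasSum_fiber {ι E : Type*} [NormedAddCommGroup E] [CompleteSpace E] {f : ι → E}
    (hf : Summable fun p => ‖f p‖) (g : ι → ℕ) :
    HasSum (fun k => ∑' p, if g p = k then f p else 0) (∑' p, f p) := by
  have h1 : HasSum (f ∘ Equiv.sigmaFiberEquiv g) (∑' p, f p) :=
    (Equiv.hasSum_iff (Equiv.sigmaFiberEquiv g)).2 hf.of_norm.hasSum
  have h2 := h1.sigma (fun k => (h1.summable.sigma_factor k).hasSum)
  convert! h2 using 2 with k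
  have := tsum_subtype {p | g p = k} f
  simp only [Set.indicator, Set.mem_ofPred_eq] at this
  refine Eq.trans ?_ this.symm
  congr 1
  ext p
  congr

theorem summable_fiber_norm {ι E : Type*} [NormedAddCommGroup E] [CompleteSpace E] {f : ι → E}
    (hf : Summable fun p => ‖f p‖) (g : ι → ℕ) (k : ℕ) :
    Summable fun p => ‖if g p = k then f p else 0‖ := by
  refine Summable.of_nonneg_of_le (fun p => norm_nonneg _) (fun p => ?_) hf
  split_ifs <;> simp

theorem norm_jacobiAngerCoeff_le (z : ℝ) (k : ℕ) : ‖jacobiAngerCoeff z k‖ ≤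
    ∑' p : ℕ × ℕ, if ((p.1 : ℤ) - p.2).natAbs = k then ‖jacobiAngerTerm z p‖ else 0 := by
  refine (norm_tsum_le_tsum_norm (summable_fiber_norm (summable_norm_jacobiAngerTerm z)
    (fun p : ℕ × ℕ => ((p.1 : ℤ) - p.2).natAbs) k)).trans_eq ?_
  congr 1
  ext p
  split_ifs <;> simp

/-- The weighted `ℓ¹` bound on the Chebyshev coefficients of `t ↦ e^{izt}`. -/
theorem summable_jacobiAngerCoeff_mul {A : ℝ} (hA : 0 < A) (z : ℝ) :
    Summable (fun k => ‖jacobiAngerCoeff z k‖ * A ^ k) ∧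
    ∑' k, ‖jacobiAngerCoeff z k‖ * A ^ k ≤ 2 * Real.exp (|z| / 2 * (A + A⁻¹)) := by
  obtain ⟨h1, h2⟩ := summable_jacobiAngerTerm_mul hA z
  have h3 := hasSum_fiber (f := fun p : ℕ × ℕ =>
    ‖jacobiAngerTerm z p‖ * A ^ ((p.1 : ℤ) - p.2).natAbs) h1.norm
    (fun p : ℕ × ℕ => ((p.1 : ℤ) - p.2).natAbs)
  have hle : ∀ k, ‖jacobiAngerCoeff z k‖ * A ^ k ≤ ∑' p : ℕ × ℕ,
      if ((p.1 : ℤ) - p.2).natAbs = k then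
        ‖jacobiAngerTerm z p‖ * A ^ ((p.1 : ℤ) - p.2).natAbs else 0 := by
    intro k
    refine (mul_le_mul_of_nonneg_right (norm_jacobiAngerCoeff_le z k) (by positivity)).trans_eq ?_
    rw [← tsum_mul_right]
    congr 1
    ext p
    split_ifs with h <;> simp [h]
  have hs := Summable.of_nonneg_of_le (fun p => by positivity) hle h3.summable
  exact ⟨hs, ((hs.tsum_le_tsum hle h3.summable).trans_eq h3.tsum_eq).trans h2⟩

open Polynomial.Chebyshev in
/-- The Chebyshev series of `t ↦ e^{izt}`, on the whole real line. -/
theorem hasSum_jacobiAngerCoeff (z t : ℝ) :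
    Summable (fun k : ℕ => ‖jacobiAngerCoeff z k * ((T ℝ (k : ℤ)).eval t : ℝ)‖) ∧
    HasSum (fun k : ℕ => jacobiAngerCoeff z k * ((T ℝ (k : ℤ)).eval t : ℝ))
      (Complex.exp (Complex.I * (z * t))) := by
  -- No restriction on `t`: the weight `A = 2L` can be taken as large as `t` demands.
  set L := max 1 |t|
  have hL : 1 ≤ L := le_max_left _ _
  have ht : |t| ≤ L := le_max_right _ _
  have hA : 0 < 2 * L := by linarith
  constructor
  · refine Summable.of_nonneg_of_le (fun p => norm_nonneg _) (fun k => ?_)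
      (summable_jacobiAngerCoeff_mul hA z).1
    rw [norm_mul, Complex.norm_real]
    exact mul_le_mul_of_nonneg_left (abs_eval_T_le hL ht k) (norm_nonneg _)
  · have hs : Summable (fun p : ℕ × ℕ =>
        ‖jacobiAngerTerm z p * ((T ℝ ((p.1 : ℤ) - p.2)).eval t : ℝ)‖) := by
      refine Summable.of_nonneg_of_le (fun p => norm_nonneg _) (fun p => ?_)
        (summable_jacobiAngerTerm_mul hA z).1
      rw [norm_mul, Complex.norm_real]
      exact mul_le_mul_of_nonneg_left (abs_eval_T_le hL ht _) (norm_nonneg _)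
    have h3 := hasSum_fiber hs (fun p : ℕ × ℕ => ((p.1 : ℤ) - p.2).natAbs)
    rw [(hasSum_jacobiAnger z t).tsum_eq] at h3
    convert! h3 using 2 with k
    rw [jacobiAngerCoeff, ← tsum_mul_right]
    congr 1
    ext p
    split_ifs with h
    · rw [← h, T_natAbs]
    · simp

/-! ### One-dimensional Chebyshev coefficients on `[-r, r]`. -/

/-- The weight `2^{[k > 0]} T_k(ξ/r) / (π √(r² - ξ²))` defining the Chebyshev coefficients. -/
def chebyshevWeight (r : ℝ) (k : ℕ) (ξ : ℝ) : ℝ :=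
  (2 ^ (if 0 < k then 1 else 0) * (Polynomial.Chebyshev.T ℝ (k : ℤ)).eval (ξ / r)) /
        (Real.pi * Real.sqrt (r ^ 2 - ξ ^ 2))

open Polynomial.Chebyshev in
theorem integral_comp_div_arcsine {r : ℝ} (hr : 0 < r) {f : ℝ → ℝ} (hf : Continuous f) :
    IntegrableOn (fun ξ => f (ξ / r) / (Real.pi * Real.sqrt (r ^ 2 - ξ ^ 2))) (Set.Icc (-r) r) ∧
    ∫ ξ in Set.Icc (-r) r, f (ξ / r) / (Real.pi * Real.sqrt (r ^ 2 - ξ ^ 2)) =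
      (∫ x, f x ∂measureT) / Real.pi := by
  set g : ℝ → ℝ := fun x => f x * √(1 - x ^ 2)⁻¹
  have hg : (fun ξ => f (ξ / r) / (Real.pi * Real.sqrt (r ^ 2 - ξ ^ 2))) =
      fun ξ => (Real.pi * r)⁻¹ * g (ξ / r) := by
    ext ξ
    have : r ^ 2 - ξ ^ 2 = r ^ 2 * (1 - (ξ / r) ^ 2) := by field_simp
    simp only [g]
    rw [this, Real.sqrt_mul (sq_nonneg r), Real.sqrt_sq hr.le, Real.sqrt_inv]
    field_simp
  have hgi : IntervalIntegrable g volume (-1) 1 :=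
    intervalIntegrable_sqrt_one_sub_sq_inv.continuousOn_mul hf.continuousOn
  have h2 : IntervalIntegrable (fun ξ => g (ξ / r)) volume (-r) r := by
    have := hgi.comp_mul_right (c := r⁻¹)
    simpa [div_eq_mul_inv] using this
  rw [hg]
  constructor
  · rw [integrableOn_Icc_iff_integrableOn_Ioc, ← Set.uIoc_of_le (by linarith),
      ← intervalIntegrable_iff]
    exact h2.const_mul _
  · rw [integral_measureT, integral_Icc_eq_integral_Ioc,
      ← intervalIntegral.integral_of_le (by linarith), intervalIntegral.integral_const_mul,
      intervalIntegral.integral_comp_div (fun x => g x) hr.ne', neg_div, div_self hr.ne', smul_eq_mul]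
    change _ = (∫ x in (-1)..1, g x) / Real.pi
    field_simp

theorem integrableOn_chebyshevWeight {r : ℝ} (hr : 0 < r) (k : ℕ) :
    IntegrableOn (chebyshevWeight r k) (Set.Icc (-r) r) :=
  (integral_comp_div_arcsine hr (f := fun x => 2 ^ (if 0 < k then 1 else 0) *
    (Polynomial.Chebyshev.T ℝ (k : ℤ)).eval x) (by fun_prop)).1

-- Orthogonality of the Chebyshev polynomials. The index `m` is an integer because the expansion of
-- `e^{izt}` produces `T_{a-b}` with `a - b` of either sign; `T_m` depends only on `|m|`.
open Polynomial.Chebyshev in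
theorem integral_chebyshevWeight_mul_T {r : ℝ} (hr : 0 < r) (k : ℕ) (m : ℤ) :
    IntegrableOn (fun ξ => (T ℝ m).eval (ξ / r) * chebyshevWeight r k ξ) (Set.Icc (-r) r) ∧
    ∫ ξ in Set.Icc (-r) r, (T ℝ m).eval (ξ / r) * chebyshevWeight r k ξ =
      if m.natAbs = k then 1 else 0 := by
  obtain ⟨h1, h2⟩ := integral_comp_div_arcsine hr (f := fun x => (2 ^ (if 0 < k then 1 else 0)) *
    ((T ℝ (m.natAbs : ℤ)).eval x * (T ℝ (k : ℤ)).eval x)) (by fun_prop)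
  have e : (fun ξ => (T ℝ m).eval (ξ / r) * chebyshevWeight r k ξ) = fun ξ =>
      (2 ^ (if 0 < k then 1 else 0)) *
      ((T ℝ (m.natAbs : ℤ)).eval (ξ / r) * (T ℝ (k : ℤ)).eval (ξ / r)) /
        (Real.pi * Real.sqrt (r ^ 2 - ξ ^ 2)) := by
    ext ξ
    rw [chebyshevWeight, T_natAbs]
    ring
  rw [e]
  refine ⟨h1, h2.trans ?_⟩
  rw [integral_const_mul]
  have := Real.pi_pos
  split_ifs with hk hm hm
  · subst hm
    rw [integral_T_real_mul_self_measureT_of_ne_zero hk.ne']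
    field_simp
  · rw [integral_eval_T_real_mul_eval_T_real_measureT_of_ne hm]
    simp
  · obtain rfl : k = 0 := by omega
    rw [hm]
    have := integral_eval_T_real_mul_self_measureT_zero
    push_cast at this ⊢
    rw [this]
    field_simp
  · rw [integral_eval_T_real_mul_eval_T_real_measureT_of_ne hm]
    simp

theorem integral_chebyshevWeight_zero {r : ℝ} (hr : 0 < r) :
    ∫ ξ in Set.Icc (-r) r, chebyshevWeight r 0 ξ = 1 := by
  simpa using (integral_chebyshevWeight_mul_T hr 0 0).2

theorem abs_div_le_one {r ξ : ℝ} (hr : 0 < r) (hξ : ξ ∈ Set.Icc (-r) r) : |ξ / r| ≤ 1 := by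
  rw [abs_div, abs_of_pos hr, div_le_one hr]
  exact abs_le.2 hξ

theorem abs_chebyshevWeight_le {r ξ : ℝ} (hr : 0 < r) (hξ : ξ ∈ Set.Icc (-r) r) (k : ℕ) :
    |chebyshevWeight r k ξ| ≤ 2 ^ (if 0 < k then 1 else 0) * chebyshevWeight r 0 ξ := by
  have h := Polynomial.Chebyshev.abs_eval_T_real_le_one k (abs_div_le_one hr hξ)
  have h0 : 0 ≤ Real.pi * Real.sqrt (r ^ 2 - ξ ^ 2) := by positivity
  simp only [chebyshevWeight]
  rw [abs_div, abs_of_nonneg h0, abs_mul, abs_of_nonneg (by positivity : (0:ℝ) ≤ 2 ^ _)]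
  simp only [lt_irrefl, if_false, pow_zero, Nat.cast_zero, Polynomial.Chebyshev.T_zero,
    Polynomial.eval_one, one_mul]
  rw [mul_one_div]
  gcongr
  exact mul_le_of_le_one_right (by positivity) h

theorem integral_abs_chebyshevWeight_le {r : ℝ} (hr : 0 < r) (k : ℕ) :
    ∫ ξ in Set.Icc (-r) r, |chebyshevWeight r k ξ| ≤ 2 ^ (if 0 < k then 1 else 0) := by
  calc _ ≤ ∫ ξ in Set.Icc (-r) r, 2 ^ (if 0 < k then 1 else 0) * chebyshevWeight r 0 ξ :=
        setIntegral_mono_on (integrableOn_chebyshevWeight hr k).abs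
          ((integrableOn_chebyshevWeight hr 0).const_mul _) measurableSet_Icc
          fun ξ hξ => abs_chebyshevWeight_le hr hξ k
    _ = _ := by rw [integral_const_mul, integral_chebyshevWeight_zero hr, mul_one]

/-- Integrate the Jacobi–Anger series with `z = rx`, `t = ξ/r` term by term; orthogonality keeps
exactly the pairs with `|a - b| = k`. The interchange is dominated because `|T_{a-b}| ≤ 1` on `[-1,
1]`. -/
theorem integral_exp_mul_chebyshevWeight {r : ℝ} (hr : 0 < r) (k : ℕ) (x : ℝ) :
    ∫ ξ in Set.Icc (-r) r, Complex.exp (Complex.I * ((ξ * x : ℝ) : ℂ)) * (chebyshevWeight r k ξ : ℂ) =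
      jacobiAngerCoeff (r * x) k := by
  set F : ℕ × ℕ → ℝ → ℂ := fun p ξ => jacobiAngerTerm (r * x) p *
    (((Polynomial.Chebyshev.T ℝ ((p.1 : ℤ) - p.2)).eval (ξ / r) * chebyshevWeight r k ξ : ℝ) : ℂ)
  have hint : ∀ p, IntegrableOn (F p) (Set.Icc (-r) r) := fun p =>
    (integral_chebyshevWeight_mul_T hr k _).1.ofReal.const_mul _
  have hsum : Summable fun p => ∫ ξ in Set.Icc (-r) r, ‖F p ξ‖ := by
    refine Summable.of_nonneg_of_le (fun p => integral_nonneg fun _ => norm_nonneg _) (fun p => ?_)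
      ((summable_norm_jacobiAngerTerm (r * x)).mul_right (2 ^ (if 0 < k then 1 else 0)))
    calc _ ≤ ∫ ξ in Set.Icc (-r) r, ‖jacobiAngerTerm (r * x) p‖ * |chebyshevWeight r k ξ| := by
          refine setIntegral_mono_on (hint p).norm
            ((integrableOn_chebyshevWeight hr k).abs.const_mul _) measurableSet_Icc fun ξ hξ => ?_
          simp only [F]
          rw [norm_mul, Complex.norm_real, Real.norm_eq_abs, abs_mul]
          gcongr
          exact mul_le_of_le_one_left (abs_nonneg _)
            (Polynomial.Chebyshev.abs_eval_T_real_le_one _ (abs_div_le_one hr hξ))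
      _ ≤ _ := by
          rw [integral_const_mul]
          gcongr
          exact integral_abs_chebyshevWeight_le hr k
  have h := hasSum_integral_of_summable_integral_norm hint hsum
  have e1 : ∀ ξ, ∑' p, F p ξ =
      Complex.exp (Complex.I * ((ξ * x : ℝ) : ℂ)) * (chebyshevWeight r k ξ : ℂ) := by
    intro ξ
    have h2 := (hasSum_jacobiAnger (r * x) (ξ / r)).mul_right (chebyshevWeight r k ξ : ℂ)
    have e : Complex.I * (((r * x : ℝ) : ℂ) * ((ξ / r : ℝ) : ℂ)) = Complex.I * ((ξ * x : ℝ) : ℂ) := by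
      rw [← Complex.ofReal_mul]
      congr 2
      field_simp
    rw [e] at h2
    rw [← h2.tsum_eq]
    congr 1
    ext p
    simp only [F]
    push_cast
    ring
  simp only [e1] at h
  rw [← h.tsum_eq, jacobiAngerCoeff]
  congr 1
  ext p
  simp only [F]
  rw [integral_const_mul, integral_complex_ofReal, (integral_chebyshevWeight_mul_T hr k _).2]
  split_ifs <;> simp

/-! ### Products of series and of integrals over the cube. -/

theorem hasSum_pi_prod {d : ℕ} (f : Fin d → ℕ → ℂ) (hf : ∀ i, Summable fun n => ‖f i n‖) :
    Summable (fun k : Fin d → ℕ => ‖∏ i, f i (k i)‖) ∧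
    HasSum (fun k : Fin d → ℕ => ∏ i, f i (k i)) (∏ i, ∑' n, f i n) := by
  induction d with
  | zero =>
    constructor
    · exact (hasSum_fintype _).summable
    · simp
  | succ d ih =>
    obtain ⟨h1, h2⟩ := ih (fun i => f i.succ) (fun i => hf i.succ)
    have h3 := hasSum_mul_of_summable_norm (hf 0).of_norm.hasSum h2 (hf 0) h1
    have h4 := Summable.mul_norm (hf 0) h1
    rw [Fin.prod_univ_succ]
    constructor
    · rw [← (Fin.consEquiv fun _ : Fin (d + 1) => ℕ).summable_iff]
      convert! h4 using 2 with p
      simp [Fin.consEquiv, Fin.prod_univ_succ]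
    · rw [← (Fin.consEquiv fun _ : Fin (d + 1) => ℕ).hasSum_iff]
      convert! h3 using 2 with p
      simp [Fin.consEquiv, Fin.prod_univ_succ]

variable {d : ℕ}

theorem measurableSet_cube (r : ℝ) : MeasurableSet (cube d r) := by
  have : cube d r = ⋂ j, {ξ | ξ j ∈ Set.Icc (-r) r} := by ext; simp [cube]
  rw [this]
  exact MeasurableSet.iInter fun j => measurableSet_Icc.preimage (by fun_prop)

theorem measurePreserving_ofLp_cube (r : ℝ) :
    MeasurePreserving (WithLp.ofLp : EuclideanSpace ℝ (Fin d) → Fin d → ℝ)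
      (volume.restrict (cube d r))
      (Measure.pi fun _ : Fin d => volume.restrict (Set.Icc (-r) r)) := by
  rw [← Measure.restrict_pi_pi]
  have h := (PiLp.volume_preserving_ofLp (Fin d)).restrict_preimage
    (s := Set.pi Set.univ fun _ => Set.Icc (-r) r)
    (MeasurableSet.univ_pi fun _ => measurableSet_Icc)
  convert! h using 2
  ext ξ
  simp [cube, Pi.le_def, forall_and]

theorem measurableEmbedding_ofLp :
    MeasurableEmbedding (WithLp.ofLp : EuclideanSpace ℝ (Fin d) → Fin d → ℝ) :=
  (MeasurableEquiv.toLp 2 (Fin d → ℝ)).symm.measurableEmbedding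

theorem setIntegral_cube_prod {𝕜 : Type*} [RCLike 𝕜] (r : ℝ) (f : Fin d → ℝ → 𝕜) :
    ∫ ξ in cube d r, ∏ j, f j (ξ j) = ∏ j, ∫ t in Set.Icc (-r) r, f j t := by
  rw [← integral_fintype_prod_eq_prod,
    ← (measurePreserving_ofLp_cube r).integral_comp measurableEmbedding_ofLp]

theorem integrableOn_cube_prod {r : ℝ} {f : Fin d → ℝ → ℝ}
    (hf : ∀ j, IntegrableOn (f j) (Set.Icc (-r) r)) :
    IntegrableOn (fun ξ : EuclideanSpace ℝ (Fin d) => ∏ j, f j (ξ j)) (cube d r) :=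
  (measurePreserving_ofLp_cube r).integrable_comp_of_integrable (Integrable.fintype_prod hf)

theorem inner_eq_sum (ξ x : EuclideanSpace ℝ (Fin d)) : inner ℝ ξ x = ∑ j, ξ j * x j := by
  simp [PiLp.inner_apply, mul_comm]

theorem exp_inner (ξ x : EuclideanSpace ℝ (Fin d)) :
    Complex.exp (Complex.I * ((inner ℝ ξ x : ℝ) : ℂ)) =
      ∏ j, Complex.exp (Complex.I * ((ξ j * x j : ℝ) : ℂ)) := by
  rw [inner_eq_sum, ← Complex.exp_sum, ← Finset.mul_sum, Complex.ofReal_sum]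

theorem norm_exp_inner (ξ x : EuclideanSpace ℝ (Fin d)) :
    ‖Complex.exp (Complex.I * ((inner ℝ ξ x : ℝ) : ℂ))‖ = 1 := by
  rw [mul_comm, Complex.norm_exp_ofReal_mul_I]

/-! ### Multivariate Chebyshev coefficients of data, plane waves and `𝓕 v`. -/

/-- The weight defining the multivariate Chebyshev coefficients. -/
def productWeight (r : ℝ) (k : Fin d → ℕ) (ξ : EuclideanSpace ℝ (Fin d)) : ℝ :=
  ∏ j, chebyshevWeight r (k j) (ξ j)

theorem chebyshevCoeff_eq (r : ℝ) (w : EuclideanSpace ℝ (Fin d) → ℂ) (k : Fin d → ℕ) :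
    chebyshevCoeff r w k = ∫ ξ in cube d r, w ξ * (productWeight r k ξ : ℂ) := rfl

theorem integrableOn_productWeight {r : ℝ} (hr : 0 < r) (k : Fin d → ℕ) :
    IntegrableOn (productWeight r k) (cube d r) :=
  integrableOn_cube_prod fun _ => integrableOn_chebyshevWeight hr _

theorem integrableOn_mul_productWeight {r C : ℝ} (hr : 0 < r) (k : Fin d → ℕ)
    {w : EuclideanSpace ℝ (Fin d) → ℂ}
    (hw : AEStronglyMeasurable w (volume.restrict (cube d r)))
    (hC : ∀ᵐ ξ ∂volume.restrict (cube d r), ‖w ξ‖ ≤ C) :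
    IntegrableOn (fun ξ => w ξ * (productWeight r k ξ : ℂ)) (cube d r) :=
  (integrableOn_productWeight hr k).ofReal.bdd_mul hw hC

theorem norm_chebyshevCoeff_le {r C : ℝ} (hr : 0 < r) (k : Fin d → ℕ) (hC0 : 0 ≤ C)
    {w : EuclideanSpace ℝ (Fin d) → ℂ}
    (hC : ∀ᵐ ξ ∂volume.restrict (cube d r), ‖w ξ‖ ≤ C) :
    ‖chebyshevCoeff r w k‖ ≤ C * ∏ j, 2 ^ (if 0 < k j then 1 else 0) := by
  rw [chebyshevCoeff_eq]
  calc _ ≤ ∫ ξ in cube d r, C * |productWeight r k ξ| := by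
        refine norm_integral_le_of_norm_le ((integrableOn_productWeight hr k).abs.const_mul C) ?_
        filter_upwards [hC] with ξ hξ
        rw [norm_mul, Complex.norm_real, Real.norm_eq_abs]
        gcongr
    _ = C * ∏ j, ∫ t in Set.Icc (-r) r, |chebyshevWeight r (k j) t| := by
        rw [integral_const_mul, ← setIntegral_cube_prod]
        simp only [productWeight, Finset.abs_prod]
    _ ≤ _ := by
        refine mul_le_mul_of_nonneg_left (Finset.prod_le_prod
          (fun j _ => integral_nonneg fun _ => abs_nonneg _)
          fun j _ => integral_abs_chebyshevWeight_le hr _) hC0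

theorem chebyshevCoeff_add {r C₁ C₂ : ℝ} (hr : 0 < r) (k : Fin d → ℕ)
    {w₁ w₂ : EuclideanSpace ℝ (Fin d) → ℂ}
    (hw₁ : AEStronglyMeasurable w₁ (volume.restrict (cube d r)))
    (hC₁ : ∀ᵐ ξ ∂volume.restrict (cube d r), ‖w₁ ξ‖ ≤ C₁)
    (hw₂ : AEStronglyMeasurable w₂ (volume.restrict (cube d r)))
    (hC₂ : ∀ᵐ ξ ∂volume.restrict (cube d r), ‖w₂ ξ‖ ≤ C₂) :
    chebyshevCoeff r (fun ξ => w₁ ξ + w₂ ξ) k = chebyshevCoeff r w₁ k + chebyshevCoeff r w₂ k := by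
  simp only [chebyshevCoeff_eq, add_mul]
  exact integral_add (integrableOn_mul_productWeight hr k hw₁ hC₁)
    (integrableOn_mul_productWeight hr k hw₂ hC₂)

/-- The Chebyshev coefficients of the plane wave `ξ ↦ e^{iξ·x}`. -/
def planeWaveCoeff (r : ℝ) (k : Fin d → ℕ) (x : EuclideanSpace ℝ (Fin d)) : ℂ :=
  ∏ j, jacobiAngerCoeff (r * x j) (k j)

theorem chebyshevCoeff_exp_inner {r : ℝ} (hr : 0 < r) (k : Fin d → ℕ)
    (x : EuclideanSpace ℝ (Fin d)) :
    chebyshevCoeff r (fun ξ => Complex.exp (Complex.I * ((inner ℝ ξ x : ℝ) : ℂ))) k =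
      planeWaveCoeff r k x := by
  rw [chebyshevCoeff_eq]
  simp only [exp_inner, productWeight, Complex.ofReal_prod, ← Finset.prod_mul_distrib]
  rw [setIntegral_cube_prod r (fun j t => Complex.exp (Complex.I * ((t * x j : ℝ) : ℂ)) *
    (chebyshevWeight r (k j) t : ℂ))]
  simp only [integral_exp_mul_chebyshevWeight hr, planeWaveCoeff]

theorem integrable_planeWave_kernel {r : ℝ} (hr : 0 < r) (k : Fin d → ℕ)
    {v : EuclideanSpace ℝ (Fin d) → ℂ} (hv : Integrable v) :
    Integrable (fun p : EuclideanSpace ℝ (Fin d) × EuclideanSpace ℝ (Fin d) =>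
      Complex.exp (Complex.I * ((inner ℝ p.1 p.2 : ℝ) : ℂ)) * ((productWeight r k p.1 : ℂ) * v p.2))
      ((volume.restrict (cube d r)).prod volume) :=
  ((integrableOn_productWeight hr k).ofReal.mul_prod hv).bdd_mul (c := 1)
    (by fun_prop) (.of_forall fun p => (norm_exp_inner _ _).le)

/-- Fubini: `𝓕 v` is a superposition of plane waves with density `v`, so its coefficients are the
same superposition of plane-wave coefficients. -/
theorem chebyshevCoeff_fourierTransform {r : ℝ} (hr : 0 < r) (k : Fin d → ℕ)
    {v : EuclideanSpace ℝ (Fin d) → ℂ} (hv : Integrable v) :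
    Integrable (fun x => planeWaveCoeff r k x * v x) ∧
    chebyshevCoeff r (fourierTransform v) k =
      (1 / (2 * (Real.pi : ℂ)) ^ d) * ∫ x, planeWaveCoeff r k x * v x := by
  have h := integrable_planeWave_kernel hr k hv
  have e : ∀ x, ∫ ξ in cube d r, Complex.exp (Complex.I * ((inner ℝ ξ x : ℝ) : ℂ)) *
      ((productWeight r k ξ : ℂ) * v x) = planeWaveCoeff r k x * v x := by
    intro x
    rw [← chebyshevCoeff_exp_inner hr, chebyshevCoeff_eq, ← integral_mul_const]
    simp only [mul_assoc]
  constructor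
  · simpa only [e] using h.integral_prod_right
  · simp only [← e]
    rw [← integral_integral_swap h, chebyshevCoeff_eq, ← integral_const_mul]
    congr 1
    ext ξ
    rw [fourierTransform, mul_assoc, ← integral_mul_const]
    congr 2
    ext x
    ring

theorem norm_fourierTransform_le {v : EuclideanSpace ℝ (Fin d) → ℂ} {N : ℝ}
    (hvN : ∫ x, ‖v x‖ ≤ (2 * Real.pi) ^ d * N) (ξ : EuclideanSpace ℝ (Fin d)) :
    ‖fourierTransform v ξ‖ ≤ N := by
  have hp : 0 < (2 * Real.pi) ^ d := by have := Real.pi_pos; positivity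
  have h1 : ‖∫ x, Complex.exp (Complex.I * ((inner ℝ ξ x : ℝ) : ℂ)) * v x‖ ≤
      (2 * Real.pi) ^ d * N := by
    refine (norm_integral_le_integral_norm _).trans (le_trans (le_of_eq ?_) hvN)
    simp only [norm_mul, norm_exp_inner, one_mul]
  have h2 : ‖(1 / (2 * (Real.pi : ℂ)) ^ d)‖ = ((2 * Real.pi) ^ d)⁻¹ := by
    simp [abs_of_pos Real.pi_pos]
  rw [fourierTransform, norm_mul, h2, inv_mul_le_iff₀ hp]
  exact h1

/-! ### Truncation error and noise amplification on the enlarged cube. -/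

/-- The product `∏ T_{k_j}(ξ_j / r)`. -/
def chebyshevProd (r : ℝ) (k : Fin d → ℕ) (ξ : EuclideanSpace ℝ (Fin d)) : ℝ :=
  ∏ j, (Polynomial.Chebyshev.T ℝ (k j : ℤ)).eval (ξ j / r)

theorem abs_chebyshevProd_le {r L : ℝ} (hr : 0 < r) (hL : 1 ≤ L) (k : Fin d → ℕ)
    {ξ : EuclideanSpace ℝ (Fin d)} (hξ : ξ ∈ cube d (r * L)) :
    |chebyshevProd r k ξ| ≤ ∏ j, (2 * L) ^ k j := by
  rw [chebyshevProd, Finset.abs_prod]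
  refine Finset.prod_le_prod (fun _ _ => abs_nonneg _) fun j _ => ?_
  refine abs_eval_T_le hL ?_ (k j : ℤ)
  rw [abs_div, abs_of_pos hr, div_le_iff₀ hr, mul_comm L]
  exact abs_le.2 (hξ j)

theorem hasSum_planeWave {r : ℝ} (hr : 0 < r) (ξ x : EuclideanSpace ℝ (Fin d)) :
    HasSum (fun k : Fin d → ℕ => planeWaveCoeff r k x * (chebyshevProd r k ξ : ℂ))
      (Complex.exp (Complex.I * ((inner ℝ ξ x : ℝ) : ℂ))) := by
  have h := (hasSum_pi_prod (fun j n => jacobiAngerCoeff (r * x j) n *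
    ((Polynomial.Chebyshev.T ℝ (n : ℤ)).eval (ξ j / r) : ℝ))
    (fun j => (hasSum_jacobiAngerCoeff _ _).1)).2
  simp only [(hasSum_jacobiAngerCoeff _ _).2.tsum_eq] at h
  rw [exp_inner]
  convert! h using 2 with k
  · simp [planeWaveCoeff, chebyshevProd, Finset.prod_mul_distrib]
  · congr 2
    push_cast
    have : (r : ℂ) ≠ 0 := by exact_mod_cast hr.ne'
    field_simp

/-- Truncation error of the Chebyshev series of a plane wave on an enlarged cube. -/
theorem norm_planeWave_sub_sum_le {r L ρ σ : ℝ} (hr : 0 < r) (hL : 1 ≤ L) (hρ : 1 ≤ ρ)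
    (n : ℕ) {ξ x : EuclideanSpace ℝ (Fin d)} (hξ : ξ ∈ cube d (r * L)) (hx : ∑ j, |x j| ≤ σ) :
    ‖Complex.exp (Complex.I * ((inner ℝ ξ x : ℝ) : ℂ)) -
      ∑ k ∈ multiIndices d n, planeWaveCoeff r k x * (chebyshevProd r k ξ : ℂ)‖ ≤
    (ρ ^ n)⁻¹ * (2 ^ d * Real.exp (r * σ / 2 * (2 * L * ρ + (2 * L * ρ)⁻¹))) := by
  -- The factor `(2L)^{k_j}` absorbs the growth of `T_{k_j}`; the spare `ρ^{k_j}` yields `ρ^{-n}`,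
  -- since every omitted index has total degree at least `n`.
  set A := 2 * L * ρ
  have hA : 0 < A := by positivity
  set g : (Fin d → ℕ) → ℂ := fun k => planeWaveCoeff r k x * (chebyshevProd r k ξ : ℂ)
  have h1 := hasSum_planeWave hr ξ x
  have h2 : HasSum (fun k => if k ∈ multiIndices d n then g k else 0)
      (∑ k ∈ multiIndices d n, g k) := by
    have : HasSum (fun k => if k ∈ multiIndices d n then g k else 0)
        (∑ k ∈ multiIndices d n, if k ∈ multiIndices d n then g k else 0) :=
      hasSum_sum_of_ne_finset_zero (fun k hk => by simp [hk])
    convert! this using 1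
    exact Finset.sum_congr rfl fun k hk => by simp [hk]
  have h3 := h1.sub h2
  have hb := hasSum_pi_prod (fun j n => ((‖jacobiAngerCoeff (r * x j) n‖ * A ^ n : ℝ) : ℂ))
    (fun j => by
      have := (summable_jacobiAngerCoeff_mul hA (r * x j)).1
      simpa only [Complex.norm_real] using this.norm)
  have hb2 : HasSum (fun k : Fin d → ℕ => ∏ j, (‖jacobiAngerCoeff (r * x j) (k j)‖ * A ^ (k j)))
      (∏ j, ∑' n, (‖jacobiAngerCoeff (r * x j) n‖ * A ^ n)) := by
    have := hb.2
    simp only [← Complex.ofReal_tsum] at this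
    exact_mod_cast this
  have hb3 := hb2.mul_left (ρ ^ n)⁻¹
  have hle : ∀ k, ‖g k - (if k ∈ multiIndices d n then g k else 0)‖ ≤
      (ρ ^ n)⁻¹ * ∏ j, (‖jacobiAngerCoeff (r * x j) (k j)‖ * A ^ (k j)) := by
    intro k
    split_ifs with hk
    · simp only [sub_self, norm_zero]; positivity
    · rw [mem_multiIndices, not_lt] at hk
      rw [sub_zero]
      calc ‖g k‖ ≤ (∏ j, ‖jacobiAngerCoeff (r * x j) (k j)‖) * ∏ j, (2 * L) ^ k j := by
            simp only [g]
            rw [norm_mul, Complex.norm_real, planeWaveCoeff, norm_prod]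
            exact mul_le_mul_of_nonneg_left (abs_chebyshevProd_le hr hL k hξ) (by positivity)
        _ = (ρ ^ (∑ j, k j))⁻¹ * ∏ j, (‖jacobiAngerCoeff (r * x j) (k j)‖ * A ^ (k j)) := by
            simp only [Finset.prod_mul_distrib, A, mul_pow _ ρ, Finset.prod_pow_eq_pow_sum]
            field_simp
        _ ≤ _ := by
            gcongr
  have h4 := tsum_of_norm_bounded hb3 hle
  rw [h3.tsum_eq] at h4
  refine h4.trans ?_
  gcongr
  calc _ ≤ ∏ j, (2 * Real.exp (|r * x j| / 2 * (A + A⁻¹))) := by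
        refine Finset.prod_le_prod (fun j _ => tsum_nonneg fun n => by positivity) fun j _ =>
          (summable_jacobiAngerCoeff_mul hA (r * x j)).2
    _ = 2 ^ d * Real.exp (r * (∑ j, |x j|) / 2 * (A + A⁻¹)) := by
        rw [Finset.prod_mul_distrib, ← Real.exp_sum, Finset.prod_const, Finset.card_fin,
          ← Finset.sum_mul, ← Finset.sum_div, Finset.mul_sum]
        simp only [abs_mul, abs_of_pos hr]
    _ ≤ _ := by gcongr

/-- Truncation error of the Chebyshev series of `𝓕 v` on an enlarged cube. -/
theorem norm_fourierTransform_sub_sum_le {r L ρ σ N : ℝ} (hr : 0 < r) (hL : 1 ≤ L) (hρ : 1 ≤ ρ)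
    (n : ℕ) {v : EuclideanSpace ℝ (Fin d) → ℂ} (hv : Integrable v)
    (hvN : ∫ x, ‖v x‖ ≤ (2 * Real.pi) ^ d * N)
    (hvσ : ∀ᵐ x : EuclideanSpace ℝ (Fin d), v x ≠ 0 → ∑ j, |x j| ≤ σ)
    {ξ : EuclideanSpace ℝ (Fin d)} (hξ : ξ ∈ cube d (r * L)) :
    ‖fourierTransform v ξ - ∑ k ∈ multiIndices d n,
      chebyshevCoeff r (fourierTransform v) k * (chebyshevProd r k ξ : ℂ)‖ ≤
    N * ((ρ ^ n)⁻¹ * (2 ^ d * Real.exp (r * σ / 2 * (2 * L * ρ + (2 * L * ρ)⁻¹)))) := by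
  have hp : 0 < (2 * Real.pi) ^ d := by have := Real.pi_pos; positivity
  set B := (ρ ^ n)⁻¹ * (2 ^ d * Real.exp (r * σ / 2 * (2 * L * ρ + (2 * L * ρ)⁻¹)))
  have hB : 0 ≤ B := by positivity
  have hi1 : Integrable fun x => Complex.exp (Complex.I * ((inner ℝ ξ x : ℝ) : ℂ)) * v x :=
    hv.bdd_mul (c := 1) (by fun_prop) (.of_forall fun x => (norm_exp_inner _ _).le)
  have hi2 : ∀ k ∈ multiIndices d n, Integrable fun x =>
      (chebyshevProd r k ξ : ℂ) * (planeWaveCoeff r k x * v x) := fun k _ =>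
    (chebyshevCoeff_fourierTransform hr k hv).1.const_mul _
  have e : fourierTransform v ξ - ∑ k ∈ multiIndices d n,
      chebyshevCoeff r (fourierTransform v) k * (chebyshevProd r k ξ : ℂ) =
      (1 / (2 * (Real.pi : ℂ)) ^ d) * ∫ x, (Complex.exp (Complex.I * ((inner ℝ ξ x : ℝ) : ℂ)) -
      ∑ k ∈ multiIndices d n, planeWaveCoeff r k x * (chebyshevProd r k ξ : ℂ)) * v x := by
    have : ∀ x, (Complex.exp (Complex.I * ((inner ℝ ξ x : ℝ) : ℂ)) -
      ∑ k ∈ multiIndices d n, planeWaveCoeff r k x * (chebyshevProd r k ξ : ℂ)) * v x =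
      Complex.exp (Complex.I * ((inner ℝ ξ x : ℝ) : ℂ)) * v x - ∑ k ∈ multiIndices d n,
      (chebyshevProd r k ξ : ℂ) * (planeWaveCoeff r k x * v x) := by
      intro x
      rw [sub_mul, Finset.sum_mul]
      congr 1
      exact Finset.sum_congr rfl fun k _ => by ring
    simp only [this]
    rw [integral_sub hi1 (integrable_finsetSum _ hi2), integral_finsetSum _ hi2, mul_sub,
      ← fourierTransform, Finset.mul_sum]
    congr 1
    refine Finset.sum_congr rfl fun k _ => ?_
    rw [(chebyshevCoeff_fourierTransform hr k hv).2, integral_const_mul]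
    ring
  have h2 : ‖(1 / (2 * (Real.pi : ℂ)) ^ d)‖ = ((2 * Real.pi) ^ d)⁻¹ := by
    simp [abs_of_pos Real.pi_pos]
  rw [e, norm_mul, h2, inv_mul_le_iff₀ hp]
  calc _ ≤ ∫ x, B * ‖v x‖ := by
        refine norm_integral_le_of_norm_le (hv.norm.const_mul B) ?_
        filter_upwards [hvσ] with x hx
        by_cases hvx : v x = 0
        · simp [hvx]
        · rw [norm_mul]
          gcongr
          exact norm_planeWave_sub_sum_le hr hL hρ n hξ (hx hvx)
    _ ≤ _ := by
        rw [integral_const_mul, ← mul_assoc, mul_comm]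
        gcongr

/-- The geometric series `1 + 2 (1/2 + 1/4 + ⋯) = 3`. -/
theorem sum_range_two_pow_mul_le (n : ℕ) :
    ∑ k ∈ Finset.range n, (2 : ℝ) ^ (if 0 < k then 1 else 0) * (1 / 2) ^ k ≤ 3 := by
  have h : ∀ n : ℕ, ∑ k ∈ Finset.range (n + 1), (2 : ℝ) ^ (if 0 < k then 1 else 0) * (1 / 2) ^ k =
      3 - 2 * (1 / 2) ^ n := by
    intro n
    induction n with
    | zero => norm_num
    | succ n ih =>
      rw [Finset.sum_range_succ, ih, if_pos n.succ_pos]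
      ring
  cases n with
  | zero => simp
  | succ n =>
    rw [h]
    have : (0:ℝ) ≤ 2 * (1 / 2) ^ n := by positivity
    linarith

/-- Writing `2L = 4L · (1/2)` extracts `(4L)^n`, as the total degree is at most `n`. The leftover
powers of `1/2` make the sum over all indices bounded independently of `n`, by `3` per coordinate.
-/
theorem sum_multiIndices_le {L : ℝ} (hL : 1 ≤ L) (n : ℕ) :
    ∑ k ∈ multiIndices d (n + 1), (∏ j, (2 : ℝ) ^ (if 0 < k j then 1 else 0)) * ∏ j, (2 * L) ^ k j ≤
      3 ^ d * (4 * L) ^ n := by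
  calc _ ≤ ∑ k ∈ multiIndices d (n + 1), (4 * L) ^ n *
        ∏ j, ((2 : ℝ) ^ (if 0 < k j then 1 else 0) * (1 / 2) ^ k j) := by
        refine Finset.sum_le_sum fun k hk => ?_
        rw [mem_multiIndices, Nat.lt_succ_iff] at hk
        have e : ∏ j, (2 * L) ^ k j = (4 * L) ^ (∑ j, k j) * ∏ j, (1 / 2 : ℝ) ^ k j := by
          rw [← Finset.prod_pow_eq_pow_sum, ← Finset.prod_mul_distrib]
          refine Finset.prod_congr rfl fun j _ => ?_
          rw [← mul_pow]
          congr 1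
          ring
        rw [e, Finset.prod_mul_distrib, mul_left_comm]
        gcongr
        linarith
    _ ≤ ∑ k ∈ Fintype.piFinset fun _ : Fin d => Finset.range (n + 1), (4 * L) ^ n *
        ∏ j, ((2 : ℝ) ^ (if 0 < k j then 1 else 0) * (1 / 2) ^ k j) :=
        Finset.sum_le_sum_of_subset_of_nonneg (Finset.filter_subset _ _)
          fun k _ _ => by positivity
    _ = (4 * L) ^ n * (∑ k ∈ Finset.range (n + 1),
        ((2 : ℝ) ^ (if 0 < k then 1 else 0) * (1 / 2) ^ k)) ^ d := by
        rw [← Finset.mul_sum, ← Finset.prod_univ_sum (fun _ : Fin d => Finset.range (n + 1))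
          (fun _ k => ((2 : ℝ) ^ (if 0 < k then 1 else 0) * (1 / 2) ^ k))]
        simp
    _ ≤ _ := by
        rw [mul_comm]
        gcongr
        exact sum_range_two_pow_mul_le _

/-- Error of the truncated Chebyshev series of noisy data on an enlarged cube. -/
theorem norm_fourierTransform_sub_extrapolation_le {r L ρ σ N δ : ℝ} (hr : 0 < r) (hL : 1 ≤ L)
    (hρ : 1 ≤ ρ) (hδ : 0 ≤ δ) (n : ℕ) {v w : EuclideanSpace ℝ (Fin d) → ℂ} (hv : Integrable v)
    (hvN : ∫ x, ‖v x‖ ≤ (2 * Real.pi) ^ d * N)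
    (hvσ : ∀ᵐ x : EuclideanSpace ℝ (Fin d), v x ≠ 0 → ∑ j, |x j| ≤ σ)
    (hf : AEStronglyMeasurable (fourierTransform v) (volume.restrict (cube d r)))
    (hw : AEStronglyMeasurable w (volume.restrict (cube d r)))
    (hwδ : ∀ᵐ ξ ∂volume.restrict (cube d r), ‖w ξ - fourierTransform v ξ‖ ≤ δ)
    {ξ : EuclideanSpace ℝ (Fin d)} (hξ : ξ ∈ cube d (r * L)) :
    ‖fourierTransform v ξ - ∑ k ∈ multiIndices d (n + 1),
      chebyshevCoeff r w k * (chebyshevProd r k ξ : ℂ)‖ ≤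
    N * ((ρ ^ (n + 1))⁻¹ * (2 ^ d * Real.exp (r * σ / 2 * (2 * L * ρ + (2 * L * ρ)⁻¹)))) +
      δ * (3 ^ d * (4 * L) ^ n) := by
  -- The coefficients are linear in the data, so exact signal and noise separate.
  have hc : ∀ k, chebyshevCoeff r w k = chebyshevCoeff r (fourierTransform v) k +
      chebyshevCoeff r (fun ξ => w ξ - fourierTransform v ξ) k := fun k => by
    rw [← chebyshevCoeff_add hr k hf (.of_forall fun ξ => norm_fourierTransform_le hvN ξ)
      (w₂ := fun ξ => w ξ - fourierTransform v ξ) (hw.sub hf) hwδ]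
    simp
  simp only [hc, add_mul, Finset.sum_add_distrib]
  rw [← sub_sub]
  refine (norm_sub_le _ _).trans (add_le_add
    (norm_fourierTransform_sub_sum_le hr hL hρ (n + 1) hv hvN hvσ hξ) ?_)
  refine (norm_sum_le _ _).trans ?_
  refine le_trans ?_ (mul_le_mul_of_nonneg_left (sum_multiIndices_le hL n) hδ)
  rw [Finset.mul_sum]
  refine Finset.sum_le_sum fun k _ => ?_
  rw [norm_mul, Complex.norm_real, ← mul_assoc]
  exact mul_le_mul (norm_chebyshevCoeff_le hr k hδ hwδ) (abs_chebyshevProd_le hr hL k hξ)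
    (norm_nonneg _) (by positivity)

/-! ### Balancing the parameters. -/

theorem one_le_extrapolationFactor (N r σ τ δ : ℝ) : 1 ≤ extrapolationFactor N r σ τ δ :=
  le_max_left _ _

theorem div_rpow_eq_exp {N δ : ℝ} (hN : 0 < N) (hδ : 0 < δ) (s : ℝ) :
    (δ / N) ^ s = Real.exp (-(Real.log (N / δ) * s)) := by
  rw [Real.rpow_def_of_pos (by positivity), ← inv_div N δ, Real.log_inv, neg_mul]

/-- When the extrapolation is nontrivial, the data rate `q = (1 - τ) ln(N/δ) / (rσ)` satisfies
`4L = q^τ`, and the truncation order is governed by `ln(3q)`. -/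
theorem extrapolation_parameters {N δ r σ τ : ℝ} (hδ : 0 < δ) (hδN : δ < N) (hr : 0 < r)
    (hσ : 0 < σ) (hτ : τ ∈ Set.Icc (0 : ℝ) 1) (hL : 1 < extrapolationFactor N r σ τ δ) :
    ∃ q : ℝ, 1 < q ∧ 0 < τ ∧ r * σ * q = (1 - τ) * Real.log (N / δ) ∧
      4 * extrapolationFactor N r σ τ δ = q ^ τ ∧
      truncationOrder N r σ τ δ =
        ⌈(2 - τ) * Real.log (N / δ) / (Real.log 3 + Real.log q)⌉₊ := by
  obtain ⟨h0, h1⟩ := hτ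
  have hl : 0 < Real.log (N / δ) := Real.log_pos ((one_lt_div hδ).2 hδN)
  have hrσ : 0 < r * σ := by positivity
  set q := (1 - τ) * Real.log (N / δ) / (r * σ) with hq
  have hq0 : 0 ≤ q := div_nonneg (mul_nonneg (by linarith) hl.le) hrσ.le
  have hmax : 1 < 1 / 4 * q ^ τ := by
    by_contra h
    rw [extrapolationFactor, ← hq, max_eq_left (not_lt.1 h)] at hL
    exact lt_irrefl _ hL
  have hLq : 4 * extrapolationFactor N r σ τ δ = q ^ τ := by
    rw [extrapolationFactor, ← hq, max_eq_right hmax.le]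
    ring
  have hq1 : 1 < q := by
    by_contra h
    have := Real.rpow_le_one hq0 (not_lt.1 h) h0
    linarith
  have hτ0 : 0 < τ := by
    rcases h0.lt_or_eq with h | h
    · exact h
    · rw [← h, Real.rpow_zero] at hmax
      norm_num at hmax
  refine ⟨q, hq1, hτ0, by rw [hq]; field_simp, hLq, ?_⟩
  rw [truncationOrder, if_pos hτ0, hLq, Real.log_rpow (by linarith)]
  congr 3
  field_simp

/-- The ceiling serves both estimates: with `D = ln(3q)`, the order `n + 1` satisfies `(n+1) D ≥
(2-τ) l`, which controls the tail, while `n D ≤ (2-τ) l` controls the noise. -/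
theorem exists_truncation_rate {N δ r σ τ : ℝ} (hδ : 0 < δ) (hδN : δ < N) (hr : 0 < r)
    (hσ : 0 < σ) (hτ : τ ∈ Set.Icc (0 : ℝ) 1) (hL : 1 < extrapolationFactor N r σ τ δ) :
    ∃ (n : ℕ) (ρ : ℝ), truncationOrder N r σ τ δ = n + 1 ∧ 1 ≤ ρ ∧
      (ρ ^ (n + 1))⁻¹ * Real.exp (r * σ / 2 * (2 * extrapolationFactor N r σ τ δ * ρ +
        (2 * extrapolationFactor N r σ τ δ * ρ)⁻¹)) ≤ (δ / N) ^ ((1 - τ) ^ 2) ∧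
      δ * (4 * extrapolationFactor N r σ τ δ) ^ n ≤ N * (δ / N) ^ ((1 - τ) ^ 2) := by
  obtain ⟨q, hq1, hτ0, hrσ, hLq, hn⟩ := extrapolation_parameters hδ hδN hr hσ hτ hL
  obtain ⟨-, h1⟩ := hτ
  have hN : 0 < N := hδ.trans hδN
  have hl : 0 < Real.log (N / δ) := Real.log_pos ((one_lt_div hδ).2 hδN)
  set L := extrapolationFactor N r σ τ δ
  set l := Real.log (N / δ)
  have hlog3 : 0 < Real.log 3 := Real.log_pos (by norm_num)
  have hlogq : 0 < Real.log q := Real.log_pos hq1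
  set D := Real.log 3 + Real.log q
  have hD : 0 < D := by positivity
  have hx : 0 < (2 - τ) * l / D := div_pos (mul_pos (by linarith) hl) hD
  have hn1 : 0 < truncationOrder N r σ τ δ := by rw [hn]; exact Nat.ceil_pos.2 hx
  obtain ⟨n, hn'⟩ : ∃ n, truncationOrder N r σ τ δ = n + 1 :=
    ⟨_, (Nat.succ_pred_eq_of_pos hn1).symm⟩
  rw [hn] at hn'
  have hub : (2 - τ) * l ≤ (n + 1 : ℕ) * D := by
    rw [← div_le_iff₀ hD, ← hn']
    exact Nat.le_ceil _
  have hlb : n * D ≤ (2 - τ) * l := by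
    rw [← le_div_iff₀ hD]
    have := Nat.ceil_lt_add_one hx.le
    rw [hn'] at this
    push_cast at this
    linarith
  -- That is, `ρ = (3q)^{1-τ}`, complementary to `4L = q^τ`, so that `Lρ` is at most of order `q`.
  set ρ := Real.exp ((1 - τ) * D) with hρdef
  have hρ1 : 1 ≤ ρ := Real.one_le_exp (mul_nonneg (by linarith) hD.le)
  have hLpos : 0 < L := by linarith
  have hqρ : L * ρ ≤ 3 / 4 * q := by
    have e1 : q ^ τ = Real.exp (τ * Real.log q) := by
      rw [Real.rpow_def_of_pos (by linarith), mul_comm]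
    have e2 : 4 * (L * ρ) = Real.exp ((1 - τ) * Real.log 3 + Real.log q) := by
      rw [← mul_assoc, hLq, e1, hρdef, ← Real.exp_add]
      congr 1
      ring
    have e3 : Real.exp ((1 - τ) * Real.log 3 + Real.log q) ≤ Real.exp (Real.log 3 + Real.log q) :=
      Real.exp_le_exp.2 (by nlinarith)
    rw [Real.exp_add (Real.log 3), Real.exp_log (by norm_num), Real.exp_log (by linarith)] at e3
    linarith
  have hLρ : 1 ≤ L * ρ := one_le_mul_of_one_le_of_one_le hL.le hρ1
  have hrσ0 : 0 < r * σ := by positivity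
  refine ⟨n, ρ, by rw [hn, hn'], hρ1, ?_, ?_⟩
  · rw [div_rpow_eq_exp hN hδ, hρdef, ← Real.exp_nat_mul, ← Real.exp_neg, ← Real.exp_add,
      ← hρdef]
    refine Real.exp_le_exp.2 ?_
    -- The exponential costs at most `(3/4 + 1/4)(1-τ) l`, while `ρ^{-(n+1)}` gains `(1-τ)(2-τ) l`;
    -- the net gain is `(1-τ)^2 l`.
    have e1 : r * σ / 2 * (2 * L * ρ) ≤ 3 / 4 * ((1 - τ) * l) := by
      rw [← hrσ]
      have := mul_le_mul_of_nonneg_left hqρ hrσ0.le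
      linarith
    have e2 : r * σ / 2 * (2 * L * ρ)⁻¹ ≤ 1 / 4 * ((1 - τ) * l) := by
      rw [← hrσ]
      have h2 : (2 * L * ρ)⁻¹ ≤ 2⁻¹ := inv_anti₀ (by norm_num) (by linarith)
      have h3 := mul_le_mul_of_nonneg_left h2 hrσ0.le
      have h4 := mul_le_mul_of_nonneg_left hq1.le hrσ0.le
      linarith
    have e3 := mul_le_mul_of_nonneg_left hub (by linarith : (0:ℝ) ≤ 1 - τ)
    rw [mul_add]
    nlinarith
  · have e0 : δ = N * Real.exp (-l) := by
      rw [Real.exp_neg, Real.exp_log (by positivity)]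
      field_simp
    have e1 : q ^ τ = Real.exp (τ * Real.log q) := by
      rw [Real.rpow_def_of_pos (by linarith), mul_comm]
    rw [div_rpow_eq_exp hN hδ, hLq, e1, ← Real.exp_nat_mul]
    nth_rw 1 [e0]
    rw [mul_assoc, ← Real.exp_add]
    refine mul_le_mul_of_nonneg_left (Real.exp_le_exp.2 ?_) hN.le
    -- Hence `(4L)^n = q^{τn} ≤ e^{τ(2-τ) l}`, and `1 - τ(2-τ) = (1-τ)^2`.
    have h2 : (n : ℝ) * Real.log q ≤ (2 - τ) * l := by
      refine le_trans ?_ hlb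
      exact mul_le_mul_of_nonneg_left (by linarith) (Nat.cast_nonneg n)
    have h3 := mul_le_mul_of_nonneg_left h2 hτ0.le
    nlinarith

/-! ### Fourier transforms on `L¹ ∩ L²` and Plancherel in the present normalization. -/

/-- Locally integrable functions defining the same tempered distribution agree a.e. -/
theorem ae_eq_of_integral_schwartz_mul_eq {F G : EuclideanSpace ℝ (Fin d) → ℂ}
    (hF : LocallyIntegrable F) (hG : LocallyIntegrable G)
    (h : ∀ φ : 𝓢(EuclideanSpace ℝ (Fin d), ℂ), ∫ x, φ x * F x = ∫ x, φ x * G x) : F =ᵐ[volume] G := by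
  refine ae_eq_of_integral_contDiff_smul_eq hF hG fun g hg hgc => ?_
  have hg₁ : HasCompactSupport (Complex.ofRealCLM ∘ g) := hgc.comp_left rfl
  have hg₂ : ContDiff ℝ (⊤ : ℕ∞) (Complex.ofRealCLM ∘ g) := by fun_prop
  have := h (hg₁.toSchwartzMap hg₂)
  simpa using this

theorem integral_schwartz_mul_fourierInv {f : EuclideanSpace ℝ (Fin d) → ℂ} (hf : Integrable f)
    (φ : 𝓢(EuclideanSpace ℝ (Fin d), ℂ)) :
    ∫ x, (𝓕⁻ φ : 𝓢(EuclideanSpace ℝ (Fin d), ℂ)) x * f x = ∫ x, φ x * 𝓕⁻ f x := by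
  have := VectorFourier.integral_fourierIntegral_smul_eq_flip (μ := volume) (ν := volume)
    (L := -innerₗ (EuclideanSpace ℝ (Fin d))) Real.continuous_fourierChar
    (by simpa using! continuous_inner.neg) φ.integrable hf
  rw [SchwartzMap.fourierInv_coe]
  have e : (-innerₗ (EuclideanSpace ℝ (Fin d))).flip = -innerₗ (EuclideanSpace ℝ (Fin d)) := by
    ext; simp [real_inner_comm]
  rw [e] at this
  exact this

theorem integral_schwartz_mul_fourier {f : EuclideanSpace ℝ (Fin d) → ℂ} (hf : Integrable f)
    (φ : 𝓢(EuclideanSpace ℝ (Fin d), ℂ)) :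
    ∫ x, (𝓕 φ : 𝓢(EuclideanSpace ℝ (Fin d), ℂ)) x * f x = ∫ x, φ x * 𝓕 f x := by
  have := VectorFourier.integral_fourierIntegral_smul_eq_flip (μ := volume) (ν := volume)
    (L := innerₗ (EuclideanSpace ℝ (Fin d))) Real.continuous_fourierChar
    (by simpa using! continuous_inner) φ.integrable hf
  rw [SchwartzMap.fourier_coe]
  have e : (innerₗ (EuclideanSpace ℝ (Fin d))).flip = innerₗ (EuclideanSpace ℝ (Fin d)) := by
    ext; simp
  rw [e] at this
  exact this

theorem continuous_fourier_of_integrable {f : EuclideanSpace ℝ (Fin d) → ℂ} (hf : Integrable f) :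
    Continuous (𝓕 f) :=
  VectorFourier.fourierIntegral_continuous Real.continuous_fourierChar
    (by simpa using! continuous_inner) hf

theorem continuous_fourierInv_of_integrable {f : EuclideanSpace ℝ (Fin d) → ℂ} (hf : Integrable f) :
    Continuous (𝓕⁻ f) :=
  VectorFourier.fourierIntegral_continuous Real.continuous_fourierChar
    (by simpa using! continuous_inner.neg) hf

theorem locallyIntegrable_coe_lp (f : Lp ℂ 2 (volume : Measure (EuclideanSpace ℝ (Fin d)))) :
    LocallyIntegrable f := (Lp.memLp f).locallyIntegrable (by norm_num)

/-- The `L²` transform and the integral formula define the same tempered distribution, because both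
are dual to the transform on Schwartz functions. -/
theorem coeFn_fourierInv_toLp {f : EuclideanSpace ℝ (Fin d) → ℂ} (hf : Integrable f)
    (hf2 : MemLp f 2) : (𝓕⁻ (hf2.toLp f) : Lp ℂ 2 volume) =ᵐ[volume] 𝓕⁻ f := by
  refine ae_eq_of_integral_schwartz_mul_eq (locallyIntegrable_coe_lp _)
    (continuous_fourierInv_of_integrable hf).locallyIntegrable fun φ => ?_
  have h := congrArg (fun u : 𝓢'(EuclideanSpace ℝ (Fin d), ℂ) => u φ)
    (Lp.fourierInv_toTemperedDistribution_eq (hf2.toLp f))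
  simp only [TemperedDistribution.fourierInv_apply, Lp.toTemperedDistribution_apply,
    smul_eq_mul] at h
  rw [← h, ← integral_schwartz_mul_fourierInv hf]
  refine integral_congr_ae ?_
  filter_upwards [hf2.coeFn_toLp] with x hx
  rw [hx]

theorem coeFn_fourier_toLp {f : EuclideanSpace ℝ (Fin d) → ℂ} (hf : Integrable f)
    (hf2 : MemLp f 2) : (𝓕 (hf2.toLp f) : Lp ℂ 2 volume) =ᵐ[volume] 𝓕 f := by
  refine ae_eq_of_integral_schwartz_mul_eq (locallyIntegrable_coe_lp _)
    (continuous_fourier_of_integrable hf).locallyIntegrable fun φ => ?_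
  have h := congrArg (fun u : 𝓢'(EuclideanSpace ℝ (Fin d), ℂ) => u φ)
    (Lp.fourier_toTemperedDistribution_eq (hf2.toLp f))
  simp only [TemperedDistribution.fourier_apply, Lp.toTemperedDistribution_apply,
    smul_eq_mul] at h
  rw [← h, ← integral_schwartz_mul_fourier hf]
  refine integral_congr_ae ?_
  filter_upwards [hf2.coeFn_toLp] with x hx
  rw [hx]

/-- Plancherel for a difference `v - 𝓕 D` with `v, D ∈ L¹ ∩ L²`. -/
theorem memLp_sub_fourier {v D : EuclideanSpace ℝ (Fin d) → ℂ} (hv : Integrable v)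
    (hv2 : MemLp v 2) (hD : Integrable D) (hD2 : MemLp D 2) :
    MemLp (fun x => v x - 𝓕 D x) 2 ∧
    eLpNorm (fun x => v x - 𝓕 D x) 2 = eLpNorm (fun x => 𝓕⁻ v x - D x) 2 := by
  set V := hv2.toLp v
  set W := hD2.toLp D
  have h1 : ((V - 𝓕 W : Lp ℂ 2 volume) : EuclideanSpace ℝ (Fin d) → ℂ) =ᵐ[volume]
      fun x => v x - 𝓕 D x := by
    filter_upwards [Lp.coeFn_sub V (𝓕 W), hv2.coeFn_toLp, coeFn_fourier_toLp hD hD2] with x a b c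
    rw [a, Pi.sub_apply, b, c]
  have h2 : ((𝓕⁻ V - W : Lp ℂ 2 volume) : EuclideanSpace ℝ (Fin d) → ℂ) =ᵐ[volume]
      fun x => 𝓕⁻ v x - D x := by
    filter_upwards [Lp.coeFn_sub (𝓕⁻ V) W, hD2.coeFn_toLp, coeFn_fourierInv_toLp hv hv2] with x a b c
    rw [a, Pi.sub_apply, b, c]
  refine ⟨(memLp_congr_ae h1).1 (Lp.memLp _), ?_⟩
  rw [← eLpNorm_congr_ae h1, ← eLpNorm_congr_ae h2, ← Lp.enorm_def, ← Lp.enorm_def]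
  have h3 : V - 𝓕 W = Lp.fourierTransformₗᵢ (EuclideanSpace ℝ (Fin d)) ℂ (𝓕⁻ V - W) := by
    rw [map_sub]
    congr 1
    exact (Lp.fourierTransformₗᵢ (EuclideanSpace ℝ (Fin d)) ℂ).apply_symm_apply V |>.symm
  rw [h3, ← ofReal_norm, LinearIsometryEquiv.norm_map, ofReal_norm]

theorem fourierTransform_eq_fourierInv (v : EuclideanSpace ℝ (Fin d) → ℂ)
    (η : EuclideanSpace ℝ (Fin d)) :
    (2 * (Real.pi : ℂ)) ^ d * fourierTransform v ((2 * Real.pi) • η) = 𝓕⁻ v η := by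
  have hp : (2 * (Real.pi : ℂ)) ^ d ≠ 0 := by simp [Real.pi_ne_zero]
  rw [fourierTransform, ← mul_assoc, mul_one_div_cancel hp, one_mul, Real.fourierInv_eq']
  congr 1
  ext x
  rw [inner_smul_left, smul_eq_mul, real_inner_comm]
  congr 2
  simp [mul_comm]

theorem inverseFourierTransform_eq_fourier (C : EuclideanSpace ℝ (Fin d) → ℂ)
    (x : EuclideanSpace ℝ (Fin d)) :
    inverseFourierTransform C x =
      𝓕 (fun η => (2 * (Real.pi : ℂ)) ^ d * C ((2 * Real.pi) • η)) x := by
  have hp : 0 < (2 * Real.pi) ^ d := by have := Real.pi_pos; positivity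
  have hp' : (2 * (Real.pi : ℂ)) ^ d ≠ 0 := by simp [Real.pi_ne_zero]
  have h := Measure.integral_comp_smul (volume : Measure (EuclideanSpace ℝ (Fin d)))
    (fun ξ => C ξ * Complex.exp (-(Complex.I * ((inner ℝ ξ x : ℝ) : ℂ)))) (2 * Real.pi)
  rw [finrank_euclideanSpace_fin, abs_of_pos (inv_pos.2 hp)] at h
  rw [inverseFourierTransform, Real.fourier_eq']
  have e : ∀ η : EuclideanSpace ℝ (Fin d), Complex.exp (((-2 * Real.pi * inner ℝ η x : ℝ) : ℂ) * Complex.I) •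
      ((2 * (Real.pi : ℂ)) ^ d * C ((2 * Real.pi) • η)) = (2 * (Real.pi : ℂ)) ^ d *
      (C ((2 * Real.pi) • η) * Complex.exp (-(Complex.I * ((inner ℝ ((2 * Real.pi) • η) x : ℝ) : ℂ)))) := by
    intro η
    rw [inner_smul_left, smul_eq_mul, mul_comm, mul_assoc]
    congr 3
    simp
    ring
  simp only [e]
  rw [integral_const_mul, h, Complex.real_smul]
  push_cast
  rw [← mul_assoc, mul_inv_cancel₀ hp', one_mul]

theorem sqrt_pow {x : ℝ} (hx : 0 ≤ x) (n : ℕ) : Real.sqrt (x ^ n) = Real.sqrt x ^ n := by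
  induction n with
  | zero => simp
  | succ n ih => rw [pow_succ, pow_succ, Real.sqrt_mul (pow_nonneg hx n), ih]

/-- The dilation contributes `(2π)^{-d/2}` to the `L²` norm, leaving `(2π)^{d/2}`. -/
theorem eLpNorm_scale (G : EuclideanSpace ℝ (Fin d) → ℂ) :
    eLpNorm (fun η => (2 * (Real.pi : ℂ)) ^ d * G ((2 * Real.pi) • η)) 2 =
      ENNReal.ofReal (Real.sqrt (2 * Real.pi) ^ d) * eLpNorm G 2 := by
  have hpi : 0 < 2 * Real.pi := by have := Real.pi_pos; positivity
  have hemb : MeasurableEmbedding fun η : EuclideanSpace ℝ (Fin d) => (2 * Real.pi) • η :=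
    measurableEmbedding_const_smul₀ hpi.ne'
  have h1 := hemb.eLpNorm_map_measure (g := G) (p := 2) (μ := volume)
  rw [Measure.map_addHaar_smul _ hpi.ne', eLpNorm_smul_measure_of_ne_top (by norm_num)] at h1
  have h2 : eLpNorm (fun η => (2 * (Real.pi : ℂ)) ^ d * G ((2 * Real.pi) • η)) 2 =
      ‖(2 * (Real.pi : ℂ)) ^ d‖ₑ * eLpNorm (G ∘ fun η => (2 * Real.pi) • η) 2 :=
    eLpNorm_const_smul ((2 * (Real.pi : ℂ)) ^ d) _ _ _
  rw [h2, ← h1, finrank_euclideanSpace_fin, smul_eq_mul, ← mul_assoc]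
  congr 1
  rw [← ofReal_norm, ENNReal.ofReal_rpow_of_nonneg (abs_nonneg _) (by positivity),
    ← ENNReal.ofReal_mul (norm_nonneg _)]
  congr 1
  have h3 : ‖(2 * (Real.pi : ℂ)) ^ d‖ = (2 * Real.pi) ^ d := by
    simp [abs_of_pos Real.pi_pos]
  have h4 : (1 / (2 : ℝ≥0∞)).toReal = 1 / 2 := by norm_num
  rw [h3, h4, ← Real.sqrt_eq_rpow, abs_of_pos (by positivity), Real.sqrt_inv]
  have h5 : (2 * Real.pi) ^ d = Real.sqrt ((2 * Real.pi) ^ d) * Real.sqrt ((2 * Real.pi) ^ d) :=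
    (Real.mul_self_sqrt (by positivity)).symm
  have h6 := sqrt_pow hpi.le d
  nth_rw 1 [h5]
  rw [h6]
  field_simp

/-- Plancherel's theorem in the normalization of `fourierTransform`. -/
theorem memLp_sub_inverseFourierTransform {v C : EuclideanSpace ℝ (Fin d) → ℂ} (hv : Integrable v)
    (hv2 : MemLp v 2) (hC : Integrable C) (hC2 : MemLp C 2) :
    MemLp (fun x => v x - inverseFourierTransform C x) 2 ∧
    eLpNorm (fun x => v x - inverseFourierTransform C x) 2 =
      ENNReal.ofReal (Real.sqrt (2 * Real.pi) ^ d) *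
        eLpNorm (fun ξ => fourierTransform v ξ - C ξ) 2 := by
  have hpi : 2 * Real.pi ≠ 0 := by have := Real.pi_pos; positivity
  have hD : Integrable fun η => (2 * (Real.pi : ℂ)) ^ d * C ((2 * Real.pi) • η) :=
    (hC.comp_smul hpi).const_mul _
  have hD2 : MemLp (fun η => (2 * (Real.pi : ℂ)) ^ d * C ((2 * Real.pi) • η)) 2 := by
    refine ⟨hD.1, ?_⟩
    rw [eLpNorm_scale]
    exact ENNReal.mul_lt_top ENNReal.ofReal_lt_top hC2.2
  have h := memLp_sub_fourier hv hv2 hD hD2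
  simp only [← inverseFourierTransform_eq_fourier, ← fourierTransform_eq_fourierInv,
    ← mul_sub] at h
  rwa [eLpNorm_scale (fun ξ => fourierTransform v ξ - C ξ)] at h

/-! ### Distributional derivatives as Fourier multipliers. -/

theorem smulLeftCLM_iterate_apply {g : EuclideanSpace ℝ (Fin d) → ℂ} (hg : g.HasTemperateGrowth)
    (n : ℕ) (φ : 𝓢(EuclideanSpace ℝ (Fin d), ℂ)) (x : EuclideanSpace ℝ (Fin d)) :
    ((SchwartzMap.smulLeftCLM ℂ g)^[n] φ) x = g x ^ n * φ x := by
  induction n generalizing φ with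
  | zero => simp
  | succ n ih =>
    rw [Function.iterate_succ_apply, ih, SchwartzMap.smulLeftCLM_apply_apply hg, smul_eq_mul]
    ring

theorem fourierInv_iterate_lineDeriv (y : EuclideanSpace ℝ (Fin d)) (m : ℕ)
    (u : 𝓢'(EuclideanSpace ℝ (Fin d), ℂ)) (φ : 𝓢(EuclideanSpace ℝ (Fin d), ℂ)) :
    (𝓕⁻ (∂^{fun _ : Fin m => y} u) : 𝓢'(EuclideanSpace ℝ (Fin d), ℂ)) φ =
      (-(2 * Real.pi * Complex.I)) ^ m *
        (𝓕⁻ u : 𝓢'(EuclideanSpace ℝ (Fin d), ℂ))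
          ((SchwartzMap.smulLeftCLM ℂ (fun η => ((inner ℝ η y : ℝ) : ℂ)))^[m] φ) := by
  induction m generalizing φ with
  | zero => simp
  | succ m ih =>
    rw [LineDeriv.iteratedLineDerivOp_const_eq_iter_lineDerivOp, Function.iterate_succ_apply',
      ← LineDeriv.iteratedLineDerivOp_const_eq_iter_lineDerivOp,
      TemperedDistribution.fourierInv_lineDerivOp_eq, Function.iterate_succ_apply, pow_succ',
      mul_assoc (-(2 * Real.pi * Complex.I)), ← ih]
    rfl

/-- The Fourier multiplier of a distributional derivative in `L²`. -/
theorem eLpNorm_mul_fourierTransform_le {v : EuclideanSpace ℝ (Fin d) → ℂ} (hv : Integrable v)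
    (hv2 : MemLp v 2) (m : ℕ) (j : Fin d) :
    ENNReal.ofReal (Real.sqrt (2 * Real.pi) ^ d) *
        eLpNorm (fun ξ : EuclideanSpace ℝ (Fin d) => ((ξ j : ℝ) : ℂ) ^ m * fourierTransform v ξ) 2 ≤
      l2Norm (∂^{fun _ : Fin m => EuclideanSpace.single j (1 : ℝ)}
        (hv2.toLp v : 𝓢'(EuclideanSpace ℝ (Fin d), ℂ))) := by
  -- If no `L²` function represents the derivative, the right-hand side is `∞`; only a
  -- representative `f` needs treatment.
  refine le_iInf₂ fun f hf => ?_
  rw [← eLpNorm_scale]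
  set y : EuclideanSpace ℝ (Fin d) := EuclideanSpace.single j (1 : ℝ)
  have hy : ∀ η : EuclideanSpace ℝ (Fin d), (inner ℝ η y : ℝ) = η j := fun η => by
    simp [y, EuclideanSpace.inner_single_right]
  have hgrowth : (fun η : EuclideanSpace ℝ (Fin d) => ((inner ℝ η y : ℝ) : ℂ)).HasTemperateGrowth := by
    fun_prop
  have hae : (𝓕⁻ f : Lp ℂ 2 volume) =ᵐ[volume] fun η =>
      (-(2 * Real.pi * Complex.I)) ^ m * ((η j : ℂ) ^ m * 𝓕⁻ v η) := by
    refine ae_eq_of_integral_schwartz_mul_eq (locallyIntegrable_coe_lp _)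
      (Continuous.locallyIntegrable ?_) fun φ => ?_
    · have := continuous_fourierInv_of_integrable hv
      fun_prop
    · have h := fourierInv_iterate_lineDeriv y m (hv2.toLp v : 𝓢'(EuclideanSpace ℝ (Fin d), ℂ)) φ
      rw [hf, Lp.fourierInv_toTemperedDistribution_eq, Lp.fourierInv_toTemperedDistribution_eq,
        Lp.toTemperedDistribution_apply, Lp.toTemperedDistribution_apply] at h
      simp only [smul_eq_mul, smulLeftCLM_iterate_apply hgrowth] at h
      simp only [hy] at h
      rw [h, ← integral_const_mul]
      refine integral_congr_ae ?_
      filter_upwards [coeFn_fourierInv_toLp hv hv2] with x hx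
      rw [hx]
      ring
  have hnorm : ‖f‖ₑ = ‖(𝓕⁻ f : Lp ℂ 2 volume)‖ₑ := by
    rw [← ofReal_norm, ← ofReal_norm]
    congr 1
    exact ((Lp.fourierTransformₗᵢ (EuclideanSpace ℝ (Fin d)) ℂ).symm.norm_map f).symm
  rw [hnorm, Lp.enorm_def, eLpNorm_congr_ae hae]
  -- The factor `|-2πi|^m` is what turns `η_j^m` into `ξ_j^m` for `ξ = 2πη`.
  refine (eLpNorm_congr_norm_ae (.of_forall fun η => ?_)).le
  rw [← fourierTransform_eq_fourierInv]
  simp only [norm_mul, norm_pow, norm_neg, PiLp.smul_apply, smul_eq_mul, Complex.ofReal_mul,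
    Complex.norm_I, mul_one, Complex.ofReal_ofNat]
  ring

/-! ### Error inside and outside the enlarged cube. -/

theorem continuous_fourierTransform {v : EuclideanSpace ℝ (Fin d) → ℂ} (hv : Integrable v) :
    Continuous (fourierTransform v) := by
  have hp : (2 * (Real.pi : ℂ)) ^ d ≠ 0 := by simp [Real.pi_ne_zero]
  have hpi : 2 * Real.pi ≠ 0 := by have := Real.pi_pos; positivity
  have e : fourierTransform v = fun ξ => ((2 * (Real.pi : ℂ)) ^ d)⁻¹ * 𝓕⁻ v ((2 * Real.pi)⁻¹ • ξ) := by
    ext ξ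
    rw [← fourierTransform_eq_fourierInv, smul_inv_smul₀ hpi, inv_mul_cancel_left₀ hp]
  rw [e]
  have := continuous_fourierInv_of_integrable hv
  fun_prop

theorem volume_cube (d : ℕ) {R : ℝ} (hR : 0 ≤ R) :
    volume (cube d R) = ENNReal.ofReal ((2 * R) ^ d) := by
  have h := (measurePreserving_ofLp_cube (d := d) R).measure_preimage
    (s := Set.univ) MeasurableSet.univ.nullMeasurableSet
  rw [Set.preimage_univ, Measure.restrict_apply_univ, Measure.pi_univ] at h
  rw [h, ENNReal.ofReal_pow (by positivity)]
  simp [two_mul]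

theorem cube_subset {r R : ℝ} (h : r ≤ R) : cube d r ⊆ cube d R := fun _ hξ j =>
  ⟨(neg_le_neg h).trans (hξ j).1, (hξ j).2.trans h⟩

theorem optimalExtrapolation_eq_zero {N r σ τ δ : ℝ} (hr : 0 < r)
    (w : EuclideanSpace ℝ (Fin d) → ℂ) {ξ : EuclideanSpace ℝ (Fin d)}
    (hξ : ξ ∉ cube d (r * extrapolationFactor N r σ τ δ)) :
    optimalExtrapolation N r σ τ δ w ξ = 0 := by
  have h : ξ ∉ cube d r := fun h =>
    hξ (cube_subset (le_mul_of_one_le_right hr.le (one_le_extrapolationFactor N r σ τ δ)) h)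
  rw [optimalExtrapolation, extrapolation, extrapolationRadius, if_neg h, if_neg hξ]

theorem aestronglyMeasurable_optimalExtrapolation {N r σ τ δ : ℝ}
    {w : EuclideanSpace ℝ (Fin d) → ℂ}
    (hw : AEStronglyMeasurable w (volume.restrict (cube d r))) :
    AEStronglyMeasurable (optimalExtrapolation N r σ τ δ w) volume := by
  have e : optimalExtrapolation N r σ τ δ w = (cube d r).indicator w +
      (cube d r)ᶜ.indicator ((cube d (extrapolationRadius N r σ τ δ)).indicator fun ξ =>
        ∑ k ∈ multiIndices d (truncationOrder N r σ τ δ), chebyshevCoeff r w k *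
          (chebyshevProd r k ξ : ℂ)) := by
    ext ξ
    simp only [optimalExtrapolation, extrapolation, Pi.add_apply, Set.indicator,
      Set.mem_compl_iff]
    split_ifs <;> simp_all [chebyshevProd]
  rw [e]
  refine ((aestronglyMeasurable_indicator_iff (measurableSet_cube r)).2 hw).add
    (AEStronglyMeasurable.indicator (AEStronglyMeasurable.indicator ?_ (measurableSet_cube _))
      (measurableSet_cube r).compl)
  refine Continuous.aestronglyMeasurable ?_
  simp only [chebyshevProd]
  fun_prop

/-- The uniform error of the extrapolation on the enlarged cube. -/
theorem ae_norm_fourierTransform_sub_optimalExtrapolation_le (hd : 1 ≤ d) {N δ r σ τ : ℝ}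
    (hδ : 0 < δ) (hδN : δ < N) (hr : 0 < r) (hσ : 0 < σ) (hτ : τ ∈ Set.Icc (0 : ℝ) 1)
    {v w : EuclideanSpace ℝ (Fin d) → ℂ} (hv : Integrable v)
    (hvN : ∫ x, ‖v x‖ ≤ (2 * Real.pi) ^ d * N)
    (hvσ : ∀ᵐ x : EuclideanSpace ℝ (Fin d), v x ≠ 0 → ∑ j, |x j| ≤ σ)
    (hw : AEStronglyMeasurable w (volume.restrict (cube d r)))
    (hwδ : ∀ᵐ ξ ∂volume.restrict (cube d r), ‖w ξ - fourierTransform v ξ‖ ≤ δ) :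
    ∀ᵐ ξ ∂volume.restrict (cube d (r * extrapolationFactor N r σ τ δ)),
      ‖fourierTransform v ξ - optimalExtrapolation N r σ τ δ w ξ‖ ≤
        5 ^ d * N * (δ / N) ^ ((1 - τ) ^ 2) := by
  have hN : 0 < N := hδ.trans hδN
  set P := (δ / N) ^ ((1 - τ) ^ 2)
  have hP : 0 ≤ P := by positivity
  have h0 : δ ≤ 5 ^ d * N * P := by
    have h1 : δ / N ≤ P := by
      have h2 : δ / N ≤ 1 := (div_le_one hN).2 hδN.le
      have := Real.rpow_le_rpow_of_exponent_ge (by positivity : 0 < δ / N) h2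
        (show (1 - τ) ^ 2 ≤ 1 by have := hτ.1; have := hτ.2; nlinarith)
      rwa [Real.rpow_one] at this
    rw [div_le_iff₀ hN] at h1
    have h3 : 1 * (P * N) ≤ 5 ^ d * (P * N) := by
      gcongr
      exact one_le_pow₀ (by norm_num)
    linarith
  rw [ae_restrict_iff' (measurableSet_cube r)] at hwδ
  rw [ae_restrict_iff' (measurableSet_cube _)]
  have hwδ' : ∀ᵐ ξ ∂volume.restrict (cube d r), ‖w ξ - fourierTransform v ξ‖ ≤ δ := by
    rwa [ae_restrict_iff' (measurableSet_cube r)]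
  filter_upwards [hwδ] with ξ h1 hξ
  by_cases hξr : ξ ∈ cube d r
  · rw [optimalExtrapolation, extrapolation, if_pos hξr, norm_sub_rev]
    exact (h1 hξr).trans h0
  -- A point of the enlarged cube off the data cube exists only if `L > 1`, the regime where the
  -- parameter balance is available.
  have hL : 1 < extrapolationFactor N r σ τ δ := by
    refine lt_of_le_of_ne (one_le_extrapolationFactor _ _ _ _ _) fun h => hξr ?_
    rwa [← h, mul_one] at hξ
  obtain ⟨n, ρ, hn, hρ, h2, h3⟩ := exists_truncation_rate hδ hδN hr hσ hτ hL
  have h4 := norm_fourierTransform_sub_extrapolation_le hr hL.le hρ hδ.le n hv hvN hvσ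
    (continuous_fourierTransform hv).aestronglyMeasurable hw hwδ' hξ
  rw [optimalExtrapolation, extrapolation, extrapolationRadius, if_neg hξr, if_pos hξ, hn]
  refine h4.trans ?_
  have h5 : (2 : ℝ) ^ d + 3 ^ d ≤ 5 ^ d := by
    have := pow_add_pow_le (by norm_num : (0:ℝ) ≤ 2) (by norm_num : (0:ℝ) ≤ 3) (by omega : d ≠ 0)
    norm_num at this
    exact this
  have h6 := mul_le_mul_of_nonneg_left h2 (by positivity : 0 ≤ N * 2 ^ d)
  have h7 := mul_le_mul_of_nonneg_left h3 (by positivity : (0 : ℝ) ≤ 3 ^ d)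
  have h8 := mul_le_mul_of_nonneg_right h5 (by positivity : 0 ≤ N * P)
  linarith

theorem eLpNorm_two_sq {α : Type*} [MeasurableSpace α] {μ : Measure α} (g : α → ℂ) :
    eLpNorm g 2 μ ^ 2 = ∫⁻ x, ‖g x‖ₑ ^ 2 ∂μ := by
  have := eLpNorm_nnreal_pow_eq_lintegral (p := 2) (f := g) (μ := μ) (by norm_num)
  simpa using this

/-- Outside the cube, the high frequencies are controlled by the Sobolev seminorm. -/
theorem eLpNorm_indicator_compl_cube_le {v : EuclideanSpace ℝ (Fin d) → ℂ} (hv : Integrable v)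
    (hv2 : MemLp v 2) {R γ : ℝ} (hR : 0 < R) (hγ : 0 < γ) (m : ℕ)
    (hvγ : sobolevSeminorm m (hv2.toLp v : 𝓢'(EuclideanSpace ℝ (Fin d), ℂ)) ≤ ENNReal.ofReal γ) :
    ENNReal.ofReal (Real.sqrt (2 * Real.pi) ^ d) *
      eLpNorm ((cube d R)ᶜ.indicator (fourierTransform v)) 2 ≤
    ENNReal.ofReal (γ * R ^ (-(m : ℤ))) := by
  set c := ENNReal.ofReal (Real.sqrt (2 * Real.pi) ^ d)
  set f := fourierTransform v
  have hf : Continuous f := continuous_fourierTransform hv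
  have h1 : (ENNReal.ofReal (R ^ m) * eLpNorm ((cube d R)ᶜ.indicator f) 2) ^ 2 ≤
      ∑ j, eLpNorm (fun ξ : EuclideanSpace ℝ (Fin d) => ((ξ j : ℝ) : ℂ) ^ m * f ξ) 2 ^ 2 := by
    rw [mul_pow]
    simp only [eLpNorm_two_sq]
    rw [← lintegral_const_mul' _ _ (by simp),
      ← lintegral_finsetSum' _ (fun j _ => by fun_prop)]
    refine lintegral_mono fun ξ => ?_
    by_cases hξ : ξ ∈ cube d R
    · simp [hξ]
    · rw [Set.indicator_of_mem (by exact hξ)]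
      obtain ⟨j, hj⟩ : ∃ j, R < |ξ j| := by
        by_contra! h
        exact hξ fun j => abs_le.1 (h j)
      refine le_trans ?_ (Finset.single_le_sum (f := fun j => ‖((ξ j : ℝ) : ℂ) ^ m * f ξ‖ₑ ^ 2)
        (fun _ _ => zero_le) (Finset.mem_univ j))
      simp only
      rw [enorm_mul, mul_pow]
      gcongr
      rw [← ofReal_norm, norm_pow, Complex.norm_real, Real.norm_eq_abs]
      gcongr
  have h2 : (c * (ENNReal.ofReal (R ^ m) * eLpNorm ((cube d R)ᶜ.indicator f) 2)) ^ 2 ≤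
      ENNReal.ofReal γ ^ 2 := by
    rw [mul_pow]
    refine (mul_le_mul_right h1 _).trans ?_
    rw [Finset.mul_sum]
    simp only [← mul_pow]
    refine (Finset.sum_le_sum fun j _ =>
      pow_le_pow_left₀ zero_le (eLpNorm_mul_fourierTransform_le hv hv2 m j) 2).trans ?_
    rw [sobolevSeminorm] at hvγ
    have := pow_le_pow_left₀ zero_le hvγ 2
    rwa [← ENNReal.rpow_mul_natCast, Nat.cast_ofNat, one_div,
      inv_mul_cancel₀ (by norm_num), ENNReal.rpow_one] at this
  have h3 := (ENNReal.pow_right_strictMono two_ne_zero).le_iff_le.1 h2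
  have hRm : 0 < R ^ m := by positivity
  rw [mul_left_comm] at h3
  rw [zpow_neg, zpow_natCast, ENNReal.ofReal_mul hγ.le, ENNReal.ofReal_inv_of_pos hRm,
    ← div_eq_mul_inv, ENNReal.le_div_iff_mul_le (by simp [hRm]) (by simp), mul_comm]
  exact h3

/-- The `20` is `5 · 4`, with `√(4π) ≤ 4`. The volume produces only `L^{d/2}`; the extra power of
`L` is slack. -/
theorem error_constant_le {N r L P : ℝ} (hN : 0 < N) (hr : 0 < r) (hL : 1 ≤ L) (hP : 0 ≤ P) :
    Real.sqrt (2 * Real.pi) ^ d * (Real.sqrt (2 * (r * L)) ^ d * (5 ^ d * N * P)) ≤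
      (20 * Real.sqrt r) ^ d * N * L ^ ((d : ℝ) / 2 + 1) * P := by
  have e : Real.sqrt (2 * Real.pi) ^ d * (Real.sqrt (2 * (r * L)) ^ d * (5 ^ d * N * P)) =
      (5 * Real.sqrt (4 * Real.pi) * Real.sqrt r) ^ d * N * Real.sqrt L ^ d * P := by
    have : Real.sqrt (2 * Real.pi) * Real.sqrt (2 * (r * L)) =
        Real.sqrt (4 * Real.pi) * Real.sqrt r * Real.sqrt L := by
      have := Real.pi_pos
      rw [← Real.sqrt_mul (by positivity), ← Real.sqrt_mul (by positivity),
        ← Real.sqrt_mul (by positivity)]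
      congr 1
      ring
    rw [← mul_assoc, ← mul_pow, this]
    simp only [mul_pow]
    ring
  have h1 : Real.sqrt (4 * Real.pi) ≤ 4 := by
    rw [Real.sqrt_le_left (by norm_num)]
    have := Real.pi_le_four
    linarith
  have h2 : Real.sqrt L ^ d ≤ L ^ ((d : ℝ) / 2 + 1) := by
    rw [Real.sqrt_eq_rpow, ← Real.rpow_mul_natCast (by linarith)]
    exact Real.rpow_le_rpow_of_exponent_le hL (by linarith)
  rw [e]
  gcongr
  linarith

end FourierSynthesis

end

theorem mainTheorem1 (d : ℕ) (hd : 1 ≤ d) (N δ r σ : ℝ)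
    (hN : 0 < N) (hδ : 0 < δ) (hr : 0 < r) (hσ : 0 < σ)
    (v w : EuclideanSpace ℝ (Fin d) → ℂ)
    (hv1 : Integrable v volume)
    (hvN : ∫ x, ‖v x‖ ≤ (2 * Real.pi) ^ d * N)
    (hvσ : ∀ᵐ x : EuclideanSpace ℝ (Fin d), v x ≠ 0 → ∑ j, |x j| ≤ σ)
    (hw : AEStronglyMeasurable w (volume.restrict (FourierSynthesis.cube d r)))
    (hwδ : eLpNorm (fun ξ => w ξ - FourierSynthesis.fourierTransform v ξ) ∞
      (volume.restrict (FourierSynthesis.cube d r)) ≤ ENNReal.ofReal δ)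
    (hδN : δ < N)
    (m : ℕ) (hm : 0 < m) (γ : ℝ) (hγ : 0 < γ)
    (hv2 : MemLp v 2 volume)
    (hvm : TemperedDistribution.MemSobolev (m : ℝ) 2
      (hv2.toLp v : 𝓢'(EuclideanSpace ℝ (Fin d), ℂ)))
    (hvγ : FourierSynthesis.sobolevSeminorm m
      (hv2.toLp v : 𝓢'(EuclideanSpace ℝ (Fin d), ℂ)) ≤ ENNReal.ofReal γ)
    (τ : ℝ) (hτ : τ ∈ Set.Icc (0 : ℝ) 1) :
    Integrable (FourierSynthesis.optimalExtrapolation N r σ τ δ w) volume ∧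
    MemLp (fun x => v x - FourierSynthesis.inverseFourierTransform
      (FourierSynthesis.optimalExtrapolation N r σ τ δ w) x) 2 volume ∧
    eLpNorm (fun x => v x - FourierSynthesis.inverseFourierTransform
      (FourierSynthesis.optimalExtrapolation N r σ τ δ w) x) 2 volume ≤
      ENNReal.ofReal
        ((20 * Real.sqrt r) ^ d * N *
            FourierSynthesis.extrapolationFactor N r σ τ δ ^ ((d : ℝ) / 2 + 1) *
            (δ / N) ^ ((1 - τ) ^ 2) +
          γ * (r * FourierSynthesis.extrapolationFactor N r σ τ δ) ^ (-(m : ℤ))) := by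
  open FourierSynthesis in
  have hwδ' : ∀ᵐ ξ ∂volume.restrict (cube d r), ‖w ξ - fourierTransform v ξ‖ ≤ δ := by
    rw [eLpNorm_exponent_top] at hwδ
    filter_upwards [ae_le_eLpNormEssSup (f := fun ξ => w ξ - fourierTransform v ξ)
      (μ := volume.restrict (cube d r))] with ξ hξ
    have := hξ.trans hwδ
    rwa [← ofReal_norm, ENNReal.ofReal_le_ofReal_iff hδ.le] at this
  set L := extrapolationFactor N r σ τ δ
  set f := fourierTransform v
  set C := optimalExtrapolation N r σ τ δ w
  set B := 5 ^ d * N * (δ / N) ^ ((1 - τ) ^ 2)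
  have hL : 1 ≤ L := one_le_extrapolationFactor _ _ _ _ _
  have hR : 0 < r * L := by positivity
  have hfin : IsFiniteMeasure (volume.restrict (cube d (r * L))) :=
    ⟨by rw [Measure.restrict_apply_univ, volume_cube d hR.le]; exact ENNReal.ofReal_lt_top⟩
  have hbound : ∀ᵐ ξ ∂volume.restrict (cube d (r * L)), ‖f ξ - C ξ‖ ≤ B :=
    ae_norm_fourierTransform_sub_optimalExtrapolation_le hd hδ hδN hr hσ hτ hv1 hvN hvσ hw hwδ'
  have hf : AEStronglyMeasurable f volume :=
    (continuous_fourierTransform hv1).aestronglyMeasurable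
  have hCm : AEStronglyMeasurable C volume := aestronglyMeasurable_optimalExtrapolation hw
  have hCz : ∀ ξ, ξ ∉ cube d (r * L) → C ξ = 0 := fun ξ hξ =>
    optimalExtrapolation_eq_zero hr w hξ
  have hCi : (cube d (r * L)).indicator C = C :=
    Set.indicator_eq_self.2 fun ξ hξ => by_contra fun h => hξ (hCz ξ h)
  have hCp : ∀ p, MemLp C p volume := by
    intro p
    rw [← hCi, memLp_indicator_iff_restrict (measurableSet_cube _)]
    refine MemLp.of_bound hCm.restrict (N + B) ?_
    filter_upwards [hbound] with ξ hξ
    have h1 := norm_fourierTransform_le hvN ξ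
    have h2 := norm_sub_norm_le (C ξ) (f ξ)
    rw [norm_sub_rev] at h2
    linarith
  have hC1 : Integrable C volume := memLp_one_iff_integrable.1 (hCp 1)
  obtain ⟨hM, hE⟩ := memLp_sub_inverseFourierTransform hv1 hv2 hC1 (hCp 2)
  refine ⟨hC1, hM, ?_⟩
  rw [hE]
  -- The triangle inequality for these two pieces gives the two terms of the estimate separately.
  have hsplit : (fun ξ => f ξ - C ξ) = (cube d (r * L)).indicator (fun ξ => f ξ - C ξ) +
      (cube d (r * L))ᶜ.indicator f := by
    ext ξ
    by_cases hξ : ξ ∈ cube d (r * L)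
    · simp [hξ]
    · simp [hξ, hCz ξ hξ]
  have hP : 0 ≤ (δ / N) ^ ((1 - τ) ^ 2) := by positivity
  have hin : eLpNorm ((cube d (r * L)).indicator (fun ξ => f ξ - C ξ)) 2 volume ≤
      ENNReal.ofReal (Real.sqrt (2 * (r * L)) ^ d * B) := by
    rw [eLpNorm_indicator_eq_eLpNorm_restrict (measurableSet_cube _)]
    refine (eLpNorm_le_of_ae_bound hbound).trans_eq ?_
    rw [Measure.restrict_apply_univ, volume_cube d hR.le, ENNReal.ofReal_mul (q := B) (by positivity),
      ENNReal.ofReal_rpow_of_nonneg (by positivity) (by positivity), ← sqrt_pow (by positivity),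
      Real.sqrt_eq_rpow, ENNReal.toReal_ofNat, one_div]
  rw [hsplit]
  refine (mul_le_mul_right (eLpNorm_add_le ((hf.sub hCm).indicator (measurableSet_cube _))
    (hf.indicator (measurableSet_cube _).compl) (by norm_num)) _).trans ?_
  rw [mul_add, ENNReal.ofReal_add (by positivity) (by positivity)]
  refine add_le_add ?_ (eLpNorm_indicator_compl_cube_le hv1 hv2 hR hγ m hvγ)
  refine (mul_le_mul_right hin _).trans ?_
  rw [← ENNReal.ofReal_mul (by positivity)]
  exact ENNReal.ofReal_le_ofReal (error_constant_le hN hr hL hP)
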